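/- Let $m\ge 2$, and let $\Sigma_m=\{0,\dots,m-1\}^{\{1,2,3,\dots\}}$ with the metric $\varrho(x,y)=m^{-\min\{n:\,x_n\neq y_n\}}$ for $x\ne y$ (and $\varrho(x,x)=0$). Let $J\ge 2$, let $p_1,\dots,p_J$ be distinct primes, and let $S=\{\ell_1<\ell_2<\cdots\}$, $\ell_1=1$, be the multiplicative semigroup of all products $p_1^{a_1}\cdots p_J^{a_J}$ with integers $a_j\ge 0$. Put $\gamma(S)=\sum_{k\ge1}\ell_k^{-1}$. Let $\Omega\subset\Sigma_m$ be a nonempty closed set and $$X_\Omega^{(S)}=\{x\in\Sigma_m:\ (x_{i\ell_k})_{k\ge1}\in\Omega\ \text{ for every integer } i\ge1 \text{ divisible by none of } p_1,\dots,p_J\}.$$ For $k\ge0$ let $\mathrm{Pref}_k(\Omega)$ be the set of words $u\in\{0,\dots,m-1\}^k$ that are the initial word of length $k$ of some element of $\Omega$, and let $\mathrm{Pref}(\Omega)=\bigcup_{k\ge0}\mathrm{Pref}_k(\Omega)$; $\varnothing$ denotes the empty word. Then there is a vector $(t(u))_{u\in\mathrm{Pref}(\Omega)}$ of real numbers such that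 $$t(\varnothing)\in[1,m],\qquad t(u)\in\bigl[1,\,m^{\ell_k(\ell_{k+1}^{-1}+\ell_{k+2}^{-1}+\cdots)}\bigr]\quad (u\in\mathrm{Pref}_k(\Omega),\ k\ge1),$$ $$t(\varnothing)^{\gamma(S)}=\sum_{j\in\mathrm{Pref}_1(\Omega)}t(j),\qquad t(u)^{\ell_{k+1}/\ell_k}=\sum_{j:\,uj\in\mathrm{Pref}_{k+1}(\Omega)}t(uj)\quad(u\in\mathrm{Pref}_k(\Omega),\ k\ge1),$$ and for every such vector the Hausdorff dimension of $X_\Omega^{(S)}$ with respect to $\varrho$ is $$\dim_H\bigl(X_\Omega^{(S)}\bigr)=\log_m t(\varnothing).$$ -/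

import Mathlib

/-- The symbolic space `Σ_m` of sequences `(x_k)_{k ≥ 1}` over the alphabet `{0, …, m-1}`.
It is a type of its own, so that it carries the metric below and not the product uniformity. -/
def SymbolSpace (m : ℕ) : Type := ℕ+ → Fin m

namespace SymbolSpace

variable {m : ℕ}

/-- `min {n ≥ 1 : x_n ≠ y_n}` (meaningful for `x ≠ y`). -/
noncomputable def firstDiff (x y : SymbolSpace m) : ℕ :=
  sInf {n : ℕ | ∃ k : ℕ+, (k : ℕ) = n ∧ x k ≠ y k}

open Classical in
/-- `ϱ(x, y) = m ^ (-min {n : x_n ≠ y_n})`, and `ϱ(x, x) = 0`. -/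
noncomputable def rho (x y : SymbolSpace m) : ℝ :=
  if x = y then 0 else ((m : ℝ) ^ firstDiff x y)⁻¹

theorem firstDiff_comm (x y : SymbolSpace m) : firstDiff x y = firstDiff y x := by
  simp only [firstDiff, ne_comm]

theorem firstDiff_spec {x y : SymbolSpace m} (h : x ≠ y) :
    ∃ k : ℕ+, (k : ℕ) = firstDiff x y ∧ x k ≠ y k := by
  obtain ⟨k, hk⟩ := Function.ne_iff.mp h
  exact Nat.sInf_mem (s := {n : ℕ | ∃ k : ℕ+, (k : ℕ) = n ∧ x k ≠ y k}) ⟨k, k, rfl, hk⟩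

theorem firstDiff_le {x y : SymbolSpace m} {k : ℕ+} (h : x k ≠ y k) :
    firstDiff x y ≤ k :=
  Nat.sInf_le ⟨k, rfl, h⟩

theorem one_le_of_elem (x : SymbolSpace m) : (1 : ℝ) ≤ m := by
  have := (x 1).pos
  exact_mod_cast this

theorem rho_nonneg (x y : SymbolSpace m) : 0 ≤ rho x y := by
  unfold rho
  split_ifs <;> positivity

theorem rho_le_of_ne {x y : SymbolSpace m} {k : ℕ+} (h : x k ≠ y k) :
    ((m : ℝ) ^ (k : ℕ))⁻¹ ≤ rho x y := by
  have hne : x ≠ y := fun e => h (by rw [e])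
  have h1 := one_le_of_elem x
  rw [rho, if_neg hne]
  exact inv_anti₀ (by positivity) (pow_le_pow_right₀ h1 (firstDiff_le h))

theorem rho_triangle (x y z : SymbolSpace m) : rho x z ≤ rho x y + rho y z := by
  by_cases hxz : x = z
  · subst hxz
    have h1 := rho_nonneg x y
    have h2 := rho_nonneg y x
    simp only [rho, if_true] at *
    linarith
  · obtain ⟨k, hk, hne⟩ := firstDiff_spec hxz
    have e : rho x z = ((m : ℝ) ^ (k : ℕ))⁻¹ := by rw [rho, if_neg hxz, hk]
    rw [e]
    by_cases hxy : x k = y k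
    · have := rho_le_of_ne (x := y) (y := z) (k := k) (by rwa [← hxy])
      linarith [rho_nonneg x y]
    · linarith [rho_le_of_ne hxy, rho_nonneg y z]

/-- The standard metric on `Σ_m`. -/
noncomputable instance : MetricSpace (SymbolSpace m) where
  dist := rho
  dist_self x := by simp [rho]
  dist_comm x y := by
    by_cases h : x = y
    · rw [h]
    · rw [rho, rho, if_neg h, if_neg (Ne.symm h), firstDiff_comm]
  dist_triangle := rho_triangle
  eq_of_dist_eq_zero {x y} h := by
    by_contra hne
    have h1 := one_le_of_elem x
    change rho x y = 0 at h
    rw [rho, if_neg hne] at h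
    have : (0 : ℝ) < ((m : ℝ) ^ firstDiff x y)⁻¹ := by positivity
    linarith

/-- The word `x_1 … x_k`. -/
def initialWord (x : SymbolSpace m) (k : ℕ) : List (Fin m) :=
  List.ofFn fun i : Fin k => x (Nat.succPNat i)

end SymbolSpace

/-- `ℓ_k`, `k ≥ 1`: the `k`-th element, in increasing order, of the multiplicative semigroup
(with `1`) generated by the set `P`. For a nonempty set `P` of primes this semigroup is an
infinite set of positive integers. (`Nat.nth` counts from `0`.) -/
noncomputable def ell (P : Finset ℕ) (k : ℕ+) : ℕ+ :=
  Nat.toPNat' (Nat.nth (fun n => n ∈ Submonoid.closure (P : Set ℕ)) k.natPred)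

/-- `x|_{iS} = (x_{i ℓ_k})_{k ≥ 1}`. -/
noncomputable def restrictTo {m : ℕ} (P : Finset ℕ) (i : ℕ+) (x : SymbolSpace m) :
    SymbolSpace m :=
  fun k => x (i * ell P k)

/-- `X_Ω^{(S)}`: all `x` with `x|_{iS} ∈ Ω` for every `i` divisible by no prime of `P`. -/
def multSet {m : ℕ} (P : Finset ℕ) (Ω : Set (SymbolSpace m)) : Set (SymbolSpace m) :=
  {x | ∀ i : ℕ+, (∀ p ∈ P, ¬ p ∣ (i : ℕ)) → restrictTo P i x ∈ Ω}

/-- `Pref(Ω)`: the finite words `u` whose cylinder `[u]` meets `Ω`. -/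
def Pref {m : ℕ} (Ω : Set (SymbolSpace m)) : Set (List (Fin m)) :=
  {u | ∃ x ∈ Ω, x.initialWord u.length = u}

/-- `γ(S) = ∑_{k ≥ 1} 1 / ℓ_k`. -/
noncomputable def gammaS (P : Finset ℕ) : ℝ :=
  ∑' k : ℕ+, ((ell P k : ℕ) : ℝ)⁻¹

/-- `1 / ℓ_{k+1} + 1 / ℓ_{k+2} + ⋯`. -/
noncomputable def ellTail (P : Finset ℕ) (k : ℕ+) : ℝ :=
  ∑' i : ℕ+, ((ell P (k + i) : ℕ) : ℝ)⁻¹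

open Classical in
/-- `∑_{j : uj ∈ Pref(Ω)} t(uj)`. -/
noncomputable def childSum {m : ℕ} (Ω : Set (SymbolSpace m)) (t : List (Fin m) → ℝ)
    (u : List (Fin m)) : ℝ :=
  ∑ j : Fin m with u ++ [j] ∈ Pref Ω, t (u ++ [j])

/-- `t = (t(u))_{u ∈ Pref(Ω)}` solves the nonlinear system on the tree of prefixes of `Ω`, with
the required bounds. Only the values of `t` on `Pref(Ω)` matter (`Ω` nonempty). -/
structure IsTreeSolution {m : ℕ} (P : Finset ℕ) (Ω : Set (SymbolSpace m))
    (t : List (Fin m) → ℝ) : Prop where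
  root_mem : t [] ∈ Set.Icc (1 : ℝ) m
  node_mem : ∀ k : ℕ+, ∀ u ∈ Pref Ω, u.length = k →
    t u ∈ Set.Icc (1 : ℝ) ((m : ℝ) ^ (((ell P k : ℕ) : ℝ) * ellTail P k))
  root_eq : t [] ^ gammaS P = childSum Ω t []
  node_eq : ∀ k : ℕ+, ∀ u ∈ Pref Ω, u.length = k →
    t u ^ (((ell P (k + 1) : ℕ) : ℝ) / ((ell P k : ℕ) : ℝ)) = childSum Ω t u

/-! Every r ≥ 1 is uniquely i·s with i prime to `P` and s in S, so the set is a product of copies of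
Ω, one along each iS. Put on each copy the Markov measure that continues u by j with probability
t(uj) / Σ t(uj'), independently over i. Along y ∈ Ω let a_0 = 0, a_k = log t(y_1…y_k), and let h_0 =
0, h_{k+1} - h_k = a_{k+1} - (ℓ_{k+1}/ℓ_k) a_k. By the system, the prefix of length K ≥ 1 has mass
exp(h_K - γ log t(∅)) (`prod_weight_eq`). Hence a cylinder of length n around a point of the set has
mass exp(H(n) - γ log t(∅) · #{i ≤ n prime to `P`}), with H = `excessSum` (`forestLaw_weave_cyl`).
Integers prime to `P` have density 1/γ, so the dimension is log_m t(∅) as soon as H(n) is negligible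
against n, in the sense required by each half of the mass distribution principle.

Upper bound: at every point, H(n) ≥ -εn for infinitely many n. Indeed H(n+1) - H(n) = (n+1)(G(n+1) -
G(n)) with G ≥ 0 (`excessSum_sub`), and the averages of G cannot decrease like the harmonic series
forever. Only t ≥ 1 enters here.

Lower bound: almost surely H(n) ≤ εn eventually (`ae_eventually_excessSum_le`). Words longer than M
come from at most n/ℓ_{M+1} indices i, each contributing at most γ log t(∅), since probabilities are
at most 1. For the others the strong law gives the mean of γ⁻¹ Σ_{k≤M} (1/ℓ_k - 1/ℓ_{k+1}) h_k. By
Abel summation the sum is a_M/ℓ_M - h_M/ℓ_{M+1}, which is uniformly small by the upper bounds on t.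

Existence of t: the right-hand sides are monotone in t and the bounds cut out a complete lattice, so
Knaster–Tarski applies. -/

open Filter Topology MeasureTheory ProbabilityTheory
open scoped ENNReal

/-- The multiplicative semigroup generated by `P`, as a predicate. -/
def InSemi (P : Finset ℕ) (n : ℕ) : Prop := n ∈ Submonoid.closure (P : Set ℕ)

/-- The natural numbers divisible by no element of `P`. -/
def Cop (P : Finset ℕ) (n : ℕ) : Prop := ∀ p ∈ P, ¬ p ∣ n

instance (P : Finset ℕ) : DecidablePred (Cop P) := fun n => by unfold Cop; infer_instance

noncomputable instance (P : Finset ℕ) : DecidablePred (InSemi P) := Classical.decPred _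

/-- The increasing enumeration of the semigroup, starting at index `0`. -/
noncomputable def semiNth (P : Finset ℕ) (k : ℕ) : ℕ := Nat.nth (InSemi P) k

/-- The number of elements of the semigroup that are at most `x`. -/
noncomputable def semiCount (P : Finset ℕ) (x : ℕ) : ℕ := Nat.count (InSemi P) (x + 1)

/-! ### The semigroup S and the density of the integers prime to `P`. With indices from 0, `semiNth
P k` is ℓ_{k+1}. -/

section Semigroup

variable {P : Finset ℕ}

theorem inSemi_one : InSemi P 1 := Submonoid.one_mem _

theorem InSemi.mul {a b : ℕ} (ha : InSemi P a) (hb : InSemi P b) : InSemi P (a * b) :=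
  Submonoid.mul_mem _ ha hb

theorem inSemi_of_mem {p : ℕ} (hp : p ∈ P) : InSemi P p := Submonoid.subset_closure hp

theorem InSemi.pos (hP : ∀ p ∈ P, p.Prime) {n : ℕ} (h : InSemi P n) : 0 < n := by
  induction h using Submonoid.closure_induction with
  | mem x hx => exact (hP x hx).pos
  | one => exact one_pos
  | mul x y _ _ hx hy => exact Nat.mul_pos hx hy

theorem inSemi_infinite (hP : ∀ p ∈ P, p.Prime) (hne : P.Nonempty) :
    (Set.ofPred (InSemi P)).Infinite := by
  obtain ⟨p, hp⟩ := hne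
  refine Set.infinite_of_injective_forall_mem (f := fun n : ℕ => p ^ n)
    (Nat.pow_right_injective (hP p hp).two_le) fun n => ?_
  exact Submonoid.pow_mem _ (inSemi_of_mem hp) n

theorem inSemi_iff_factored (hP : ∀ p ∈ P, p.Prime) {n : ℕ} :
    InSemi P n ↔ n ∈ Nat.factoredNumbers P := by
  constructor
  · intro h
    induction h using Submonoid.closure_induction with
    | mem x hx =>
      refine ⟨(hP x hx).ne_zero, fun q hq => ?_⟩
      rw [Nat.primeFactorsList_prime (hP x hx)] at hq
      rw [List.mem_singleton.mp hq]; exact hx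
    | one => exact Nat.mem_factoredNumbers.2 ⟨one_ne_zero, by simp⟩
    | mul x y _ _ hx hy => exact Nat.mul_mem_factoredNumbers hx hy
  · rintro ⟨h0, h⟩
    rw [← Nat.prod_primeFactorsList h0]
    exact Submonoid.list_prod_mem _ fun q hq => inSemi_of_mem (h q hq)

theorem semiNth_mem (hP : ∀ p ∈ P, p.Prime) (hne : P.Nonempty) (k : ℕ) :
    InSemi P (semiNth P k) := Nat.nth_mem_of_infinite (inSemi_infinite hP hne) k

theorem semiNth_strictMono (hP : ∀ p ∈ P, p.Prime) (hne : P.Nonempty) :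
    StrictMono (semiNth P) := Nat.nth_strictMono (inSemi_infinite hP hne)

theorem semiNth_pos (hP : ∀ p ∈ P, p.Prime) (hne : P.Nonempty) (k : ℕ) :
    0 < semiNth P k := (semiNth_mem hP hne k).pos hP

theorem exists_semiNth {n : ℕ} (h : InSemi P n) : ∃ k, semiNth P k = n :=
  ⟨_, Nat.nth_count h⟩

theorem semiNth_zero (hP : ∀ p ∈ P, p.Prime) (hne : P.Nonempty) : semiNth P 0 = 1 := by
  obtain ⟨k, hk⟩ := exists_semiNth (inSemi_one (P := P))
  have h1 := (semiNth_strictMono hP hne).monotone (Nat.zero_le k)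
  have h2 := semiNth_pos hP hne 0
  omega

theorem ell_succPNat (hP : ∀ p ∈ P, p.Prime) (hne : P.Nonempty) (k : ℕ) :
    (ell P (Nat.succPNat k) : ℕ) = semiNth P k := by
  have h : ell P (Nat.succPNat k) = Nat.toPNat' (semiNth P k) := by
    simp only [ell, Nat.natPred_succPNat]; rfl
  rw [h, Nat.toPNat'_coe, if_pos (semiNth_pos hP hne k)]

theorem lt_semiCount (hP : ∀ p ∈ P, p.Prime) (hne : P.Nonempty) {k x : ℕ} :
    k < semiCount P x ↔ semiNth P k ≤ x := by
  have h := Nat.count_le_iff_le_nth (inSemi_infinite hP hne) (a := x + 1) (b := k)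
  unfold semiCount semiNth
  rw [← Nat.lt_succ_iff, ← not_le, ← not_le, h]

theorem semiCount_zero (hP : ∀ p ∈ P, p.Prime) : semiCount P 0 = 0 := by
  have : ¬ InSemi P 0 := fun h => absurd (h.pos hP) (lt_irrefl 0)
  simp [semiCount, Nat.count_succ, this]

theorem semiCount_succ_of (x : ℕ) (h : InSemi P (x + 1)) :
    semiCount P (x + 1) = semiCount P x + 1 := by
  rw [semiCount, Nat.count_succ, if_pos h, semiCount]

theorem semiCount_succ_of_not (x : ℕ) (h : ¬ InSemi P (x + 1)) :
    semiCount P (x + 1) = semiCount P x := by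
  rw [semiCount, Nat.count_succ, if_neg h, semiCount, add_zero]

theorem semiNth_semiCount (x : ℕ) (h : InSemi P (x + 1)) :
    semiNth P (semiCount P x) = x + 1 := Nat.nth_count h

theorem Cop.ne_zero (hne : P.Nonempty) {i : ℕ} (h : Cop P i) : i ≠ 0 := by
  rintro rfl
  obtain ⟨p, hp⟩ := hne
  exact h p hp (dvd_zero _)

theorem Cop.coprime (hP : ∀ p ∈ P, p.Prime) {i s : ℕ} (hi : Cop P i) (hs : InSemi P s) :
    Nat.Coprime i s := by
  induction hs using Submonoid.closure_induction with
  | mem x hx => exact ((hP x hx).coprime_iff_not_dvd.mpr (hi x hx)).symm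
  | one => exact Nat.coprime_one_right i
  | mul x y _ _ hx hy => exact Nat.Coprime.mul_right hx hy

theorem cop_mul_semi_unique (hP : ∀ p ∈ P, p.Prime) {i i' s s' : ℕ}
    (hi : Cop P i) (hi' : Cop P i') (hs : InSemi P s) (hs' : InSemi P s')
    (h : i * s = i' * s') : i = i' ∧ s = s' := by
  have h1 : s ∣ s' := (hi'.coprime hP hs).symm.dvd_of_dvd_mul_left (h ▸ dvd_mul_left s i)
  have h2 : s' ∣ s := (hi.coprime hP hs').symm.dvd_of_dvd_mul_left (h ▸ dvd_mul_left s' i')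
  have h3 := Nat.dvd_antisymm h1 h2
  subst h3
  exact ⟨Nat.eq_of_mul_eq_mul_right (hs.pos hP) h, rfl⟩

theorem exists_cop_mul_semi (hP : ∀ p ∈ P, p.Prime) {r : ℕ} (hr : 0 < r) :
    ∃ i s, Cop P i ∧ InSemi P s ∧ i * s = r := by
  induction r using Nat.strong_induction_on with
  | _ r ih =>
    by_cases h : Cop P r
    · exact ⟨r, 1, h, inSemi_one, mul_one r⟩
    · simp only [Cop, not_forall, not_not] at h
      obtain ⟨p, hp, q, rfl⟩ := h
      have hq : 0 < q := Nat.pos_of_mul_pos_left hr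
      obtain ⟨i, s, hi, hs, rfl⟩ := ih q (lt_mul_of_one_lt_left hq (hP p hp).one_lt) hq
      exact ⟨i, p * s, hi, (inSemi_of_mem hp).mul hs, by ring⟩

/-- The Euler product restricted to the primes of `P`. -/
theorem hasSum_semiNth_inv (hP : ∀ p ∈ P, p.Prime) (hne : P.Nonempty) :
    HasSum (fun k => ((semiNth P k : ℕ) : ℝ)⁻¹) (∏ p ∈ P, (1 - (p : ℝ)⁻¹)⁻¹) := by
  let f : ℕ →* ℝ := ⟨⟨fun n => (n : ℝ)⁻¹, by simp⟩, fun x y => by push_cast; rw [mul_inv]⟩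
  have hf : ∀ {p : ℕ}, p.Prime → ‖f p‖ < 1 := by
    intro p hp
    have h1 : (1 : ℝ) < p := by exact_mod_cast hp.one_lt
    have h2 : f p = (p : ℝ)⁻¹ := rfl
    rw [h2, norm_inv, RCLike.norm_natCast]
    exact inv_lt_one_of_one_lt₀ h1
  have h := (EulerProduct.summable_and_hasSum_factoredNumbers_prod_filter_prime_geometric hf P).2
  rw [Finset.filter_true_of_mem hP] at h
  let g : ℕ ≃ Nat.factoredNumbers P := Equiv.ofBijective
    (fun k => ⟨semiNth P k, (inSemi_iff_factored hP).1 (semiNth_mem hP hne k)⟩) (by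
      constructor
      · intro a b hab
        exact (semiNth_strictMono hP hne).injective (congrArg Subtype.val hab)
      · rintro ⟨n, hn⟩
        obtain ⟨k, hk⟩ := exists_semiNth ((inSemi_iff_factored hP).2 hn)
        exact ⟨k, Subtype.ext hk⟩)
  exact (g.hasSum_iff (f := fun m : Nat.factoredNumbers P => f m)).2 h

theorem gammaS_eq (hP : ∀ p ∈ P, p.Prime) (hne : P.Nonempty) :
    gammaS P = ∑' k : ℕ, ((semiNth P k : ℕ) : ℝ)⁻¹ := by
  rw [gammaS, ← Equiv.pnatEquivNat.symm.tsum_eq]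
  exact tsum_congr fun k => by rw [← ell_succPNat hP hne]; rfl

theorem summable_semiNth_inv (hP : ∀ p ∈ P, p.Prime) (hne : P.Nonempty) :
    Summable (fun k => ((semiNth P k : ℕ) : ℝ)⁻¹) := (hasSum_semiNth_inv hP hne).summable

theorem gammaS_eq_prod (hP : ∀ p ∈ P, p.Prime) (hne : P.Nonempty) :
    gammaS P = ∏ p ∈ P, (1 - (p : ℝ)⁻¹)⁻¹ := by
  rw [gammaS_eq hP hne, (hasSum_semiNth_inv hP hne).tsum_eq]

theorem one_le_gammaS (hP : ∀ p ∈ P, p.Prime) (hne : P.Nonempty) : 1 ≤ gammaS P := by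
  rw [gammaS_eq hP hne]
  refine le_trans ?_ ((summable_semiNth_inv hP hne).le_tsum 0 fun _ _ => by positivity)
  simp [semiNth_zero hP hne]

theorem ellTail_eq (hP : ∀ p ∈ P, p.Prime) (hne : P.Nonempty) (k : ℕ) :
    ellTail P (Nat.succPNat k) = ∑' i : ℕ, ((semiNth P (i + (k + 1)) : ℕ) : ℝ)⁻¹ := by
  rw [ellTail, ← Equiv.pnatEquivNat.symm.tsum_eq]
  refine tsum_congr fun i => ?_
  rw [show (Nat.succPNat k + Equiv.pnatEquivNat.symm i : ℕ+) = Nat.succPNat (i + (k + 1)) from ?_,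
    ell_succPNat hP hne]
  apply PNat.eq
  simp [Equiv.pnatEquivNat]
  omega

theorem ellTail_succ (hP : ∀ p ∈ P, p.Prime) (hne : P.Nonempty) (k : ℕ) :
    ellTail P (Nat.succPNat k) =
      ((semiNth P (k + 1) : ℕ) : ℝ)⁻¹ + ellTail P (Nat.succPNat (k + 1)) := by
  rw [ellTail_eq hP hne, ellTail_eq hP hne,
    ((summable_nat_add_iff (k + 1)).2 (summable_semiNth_inv hP hne)).tsum_eq_zero_add]
  simp only [zero_add]
  congr 1
  exact tsum_congr fun i => by rw [show i + 1 + (k + 1) = i + (k + 1 + 1) by ring]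

theorem gammaS_eq_add (hP : ∀ p ∈ P, p.Prime) (hne : P.Nonempty) :
    gammaS P = 1 + ellTail P (Nat.succPNat 0) := by
  rw [gammaS_eq hP hne, ellTail_eq hP hne, (summable_semiNth_inv hP hne).tsum_eq_zero_add,
    semiNth_zero hP hne]
  simp

theorem ellTail_nonneg (k : ℕ+) : 0 ≤ ellTail P k := tsum_nonneg fun _ => by positivity

theorem tendsto_ellTail (hP : ∀ p ∈ P, p.Prime) (hne : P.Nonempty) :
    Tendsto (fun k => ellTail P (Nat.succPNat k)) atTop (𝓝 0) := by
  simp only [ellTail_eq hP hne]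
  exact (tendsto_sum_nat_add fun k => ((semiNth P k : ℕ) : ℝ)⁻¹).comp (tendsto_add_atTop_nat 1)

/-- The number of elements of `Cop P` that are at most `n`. -/
def copCount (P : Finset ℕ) (n : ℕ) : ℕ := Nat.count (Cop P) (n + 1)

theorem cop_iff_coprime (hP : ∀ p ∈ P, p.Prime) {n : ℕ} : Cop P n ↔ (∏ p ∈ P, p).Coprime n := by
  rw [Nat.coprime_prod_left_iff]
  exact forall₂_congr fun p hp => (hP p hp).coprime_iff_not_dvd.symm

theorem totient_prod_div (hP : ∀ p ∈ P, p.Prime) (hne : P.Nonempty) :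
    ((∏ p ∈ P, p).totient : ℝ) / ((∏ p ∈ P, p : ℕ) : ℝ) = (gammaS P)⁻¹ := by
  have h0 : ((∏ p ∈ P, p : ℕ) : ℝ) ≠ 0 := by
    exact_mod_cast Finset.prod_ne_zero_iff.2 fun p hp => (hP p hp).ne_zero
  have h := Nat.totient_eq_mul_prod_factors (∏ p ∈ P, p)
  rw [Nat.primeFactors_prod hP] at h
  have h' : ((∏ p ∈ P, p).totient : ℝ) =
      ((∏ p ∈ P, p : ℕ) : ℝ) * ∏ p ∈ P, (1 - (p : ℝ)⁻¹) := by
    have h2 := congrArg (Rat.cast (K := ℝ)) h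
    simpa only [Rat.cast_natCast, Rat.cast_mul, Rat.cast_prod, Rat.cast_sub, Rat.cast_one,
      Rat.cast_inv] using h2
  rw [h', mul_div_cancel_left₀ _ h0, gammaS_eq_prod hP hne, Finset.prod_inv_distrib, inv_inv]

theorem count_cop_mul (hP : ∀ p ∈ P, p.Prime) (q : ℕ) :
    Nat.count (Cop P) ((∏ p ∈ P, p) * q) = (∏ p ∈ P, p).totient * q := by
  induction q with
  | zero => simp
  | succ q ih =>
    rw [mul_add, mul_add, mul_one, mul_one, Nat.count_add, ih]
    congr 1
    rw [Nat.totient, Nat.count_eq_card_filter_range]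
    congr 1
    ext a
    simp only [Finset.mem_filter, cop_iff_coprime hP, Nat.coprime_mul_left_add_right]

/-- Being prime to `P` is periodic modulo the product Q of the primes, with φ(Q) residue classes,
and φ(Q)/Q is the reciprocal of the Euler product for γ(S). -/
theorem tendsto_copCount_div (hP : ∀ p ∈ P, p.Prime) (hne : P.Nonempty) :
    Tendsto (fun n => (copCount P n : ℝ) / n) atTop (𝓝 (gammaS P)⁻¹) := by
  set Q := ∏ p ∈ P, p with hQ
  have hQ0 : 0 < Q := Finset.prod_pos fun p hp => (hP p hp).pos
  have hQR : (0 : ℝ) < Q := by exact_mod_cast hQ0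
  rw [← totient_prod_div hP hne, ← hQ]
  have hφ : (0 : ℝ) ≤ Q.totient := by positivity
  have key : ∀ n : ℕ, |(copCount P n : ℝ) - Q.totient / Q * n| ≤ 2 * Q.totient := by
    intro n
    have h1 : Q.totient * ((n + 1) / Q) ≤ copCount P n := by
      rw [← count_cop_mul hP]
      exact Nat.count_monotone _ (Nat.mul_div_le _ _)
    have h2 : copCount P n ≤ Q.totient * ((n + 1) / Q + 1) := by
      rw [← count_cop_mul hP]
      exact Nat.count_monotone _ (Nat.lt_mul_div_succ _ hQ0).le
    have h1' : (Q.totient : ℝ) * ((n + 1) / Q : ℕ) ≤ copCount P n := by exact_mod_cast h1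
    have h2' : (copCount P n : ℝ) ≤ Q.totient * (((n + 1) / Q : ℕ) + 1) := by exact_mod_cast h2
    have h3 : (((n + 1) / Q : ℕ) : ℝ) ≤ (n + 1) / Q := by
      have := Nat.cast_div_le (α := ℝ) (m := n + 1) (n := Q); push_cast at this; exact this
    have h4 : ((n : ℝ) + 1) / Q < ((n + 1) / Q : ℕ) + 1 := by
      rw [div_lt_iff₀ hQR]
      have := Nat.lt_mul_div_succ (n + 1) hQ0
      have : ((n + 1 : ℕ) : ℝ) < (Q * ((n + 1) / Q + 1) : ℕ) := by exact_mod_cast this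
      push_cast at this
      linarith
    have h5 : (1 : ℝ) / Q ≤ 1 := by
      rw [div_le_one hQR]; exact_mod_cast hQ0
    have e1 : (Q.totient : ℝ) / Q * n = Q.totient * (((n : ℝ) + 1) / Q - 1 / Q) := by
      field_simp; ring
    have h6 : (0 : ℝ) ≤ 1 / Q := by positivity
    rw [e1, abs_le]
    constructor <;> nlinarith
  have h0 : Tendsto (fun n : ℕ => (copCount P n : ℝ) / n - Q.totient / Q) atTop (𝓝 0) := by
    have hb : Tendsto (fun n : ℕ => 2 * (Q.totient : ℝ) / n) atTop (𝓝 0) :=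
      tendsto_const_div_atTop_nhds_zero_nat _
    refine squeeze_zero_norm' ?_ hb
    filter_upwards [eventually_gt_atTop 0] with n hn
    have hn' : (0 : ℝ) < n := by exact_mod_cast hn
    have : (copCount P n : ℝ) / n - Q.totient / Q = (copCount P n - Q.totient / Q * n) / n := by
      field_simp
    rw [this, norm_div, Real.norm_eq_abs, Real.norm_eq_abs, abs_of_pos hn']
    gcongr
    exact key n
  simpa using h0.add_const ((Q.totient : ℝ) / Q)

theorem cop_infinite (hP : ∀ p ∈ P, p.Prime) : (Set.ofPred (Cop P)).Infinite := by
  have h0 : 0 < ∏ p ∈ P, p := Finset.prod_pos fun p hp => (hP p hp).pos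
  refine Set.infinite_of_injective_forall_mem (f := fun n : ℕ => (∏ p ∈ P, p) * n + 1)
    (fun a b hab => Nat.eq_of_mul_eq_mul_left h0 (Nat.succ_injective hab)) fun n => ?_
  exact (cop_iff_coprime hP).2 (by simp)

theorem sum_filter_range_eq_sum_nth (p : ℕ → Prop) [DecidablePred p] (f : ℕ → ℝ) (n : ℕ) :
    ∑ i ∈ (Finset.range n).filter p, f i = ∑ j ∈ Finset.range (Nat.count p n), f (Nat.nth p j) := by
  induction n with
  | zero => simp
  | succ n ih =>
    rw [Finset.range_add_one, Finset.filter_insert, Nat.count_succ]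
    split_ifs with h
    · rw [Finset.sum_insert (by simp), ih, Finset.sum_range_succ, Nat.nth_count h, add_comm]
    · exact ih

end Semigroup

/-! ### Deterministic estimates for the excesses -/

section SequenceBounds

/-- Discrete integration by parts: the averages of a nonnegative `G` cannot decrease forever. -/
theorem exists_neg_mul_le_of_diff {H G : ℕ → ℝ} (hG : ∀ n, 0 ≤ G n) (hH0 : H 0 = 0)
    (hd : ∀ n : ℕ, H (n + 1) - H n = (n + 1) * (G (n + 1) - G n)) {ε : ℝ} (hε : 0 < ε) (N : ℕ) :
    ∃ n ≥ N, -(ε * n) ≤ H n := by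
  by_contra! hcon
  set S : ℕ → ℝ := fun n => ∑ j ∈ Finset.range n, G j with hS
  have hS0 : ∀ n, 0 ≤ S n := fun n => Finset.sum_nonneg fun _ _ => hG _
  have hHS : ∀ n, H n = n * G n - S n := by
    intro n
    induction n with
    | zero => simp [hS, hH0]
    | succ n ih =>
      have e : S (n + 1) = S n + G n := Finset.sum_range_succ _ _
      rw [e]; push_cast
      linarith [hd n, show H (n + 1) = H n + (H (n + 1) - H n) by ring]
  set D : ℕ → ℝ := fun n => ∑ i ∈ Finset.range n, 1 / ((i : ℝ) + 1) with hD
  -- If H n < -εn, then G n lies at least ε below the average S n / n, so including it lowers the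
  -- average by at least ε/(n+1). The harmonic series then drives the average below 0.
  have hstep : ∀ n ≥ N + 1, S n / n + ε * D n ≤ S (N + 1) / (N + 1 : ℕ) + ε * D (N + 1) := by
    intro n hn
    induction n, hn using Nat.le_induction with
    | base => exact le_rfl
    | succ n hn ih =>
      refine le_trans ?_ ih
      have hn0 : (0 : ℝ) < n := by exact_mod_cast (by omega : 0 < n)
      have e : S (n + 1) = S n + G n := Finset.sum_range_succ _ _
      have e2 : D (n + 1) = D n + 1 / ((n : ℝ) + 1) := Finset.sum_range_succ _ _
      have h1 := hcon n (by omega)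
      rw [hHS n] at h1
      have h2 : G n ≤ S n / n - ε := by
        rw [le_sub_iff_add_le, le_div_iff₀ hn0]; linarith
      have h3 : S (n + 1) / ((n : ℝ) + 1) ≤ S n / n - ε * (1 / ((n : ℝ) + 1)) := by
        rw [div_le_iff₀ (by positivity), e]
        have : (S n / n - ε * (1 / ((n : ℝ) + 1))) * (n + 1) = S n + S n / n - ε := by
          field_simp
        rw [this]; linarith
      rw [e2]; push_cast; linarith
  have hDtop : Tendsto D atTop atTop := Real.tendsto_sum_range_one_div_nat_succ_atTop
  obtain ⟨n, hn1, hn2⟩ := ((hDtop.eventually_gt_atTop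
    ((S (N + 1) / (N + 1 : ℕ) + ε * D (N + 1)) / ε)).and (eventually_ge_atTop (N + 1))).exists
  rw [div_lt_iff₀ hε] at hn1
  have := hstep n hn2
  have h0 : 0 ≤ S n / n := div_nonneg (hS0 n) (Nat.cast_nonneg n)
  linarith

variable {P : Finset ℕ}

/-- The sequence `h` with `h 0 = 0` and `h (k+1) - h k = a (k+1) - (ℓ_{k+1} / ℓ_k) a k`. -/
noncomputable def excess (P : Finset ℕ) (a : ℕ → ℝ) : ℕ → ℝ
  | 0 => 0
  | k + 1 => excess P a k + a (k + 1) - (semiNth P k : ℝ) / semiNth P (k - 1) * a k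

/-- The sum of the excesses, up to level `n`, of a family of sequences. -/
noncomputable def excessSum (P : Finset ℕ) (a : ℕ → ℕ → ℝ) (n : ℕ) : ℝ :=
  ∑ i ∈ (Finset.range (n + 1)).filter (Cop P), excess P (a i) (semiCount P (n / i))

/-- The boundary term in the summation by parts of `excessSum`. -/
noncomputable def boundarySum (P : Finset ℕ) (a : ℕ → ℕ → ℝ) (n : ℕ) : ℝ :=
  ∑ i ∈ (Finset.range (n + 1)).filter (Cop P),
    a i (semiCount P (n / i)) / (i * semiNth P (semiCount P (n / i) - 1))

/-- The word along iS grows at n+1 only if n+1 = i·ℓ with ℓ in S. The ratio in `excess` then has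
numerator ℓ = (n+1)/i, so the factor n+1 comes out of both terms. -/
theorem excess_sub_eq (hP : ∀ p ∈ P, p.Prime) (hne : P.Nonempty) {a : ℕ → ℝ}
    {i : ℕ} (hi : 0 < i) (n : ℕ) :
    excess P a (semiCount P ((n + 1) / i)) - excess P a (semiCount P (n / i)) =
      (n + 1) * (a (semiCount P ((n + 1) / i)) / (i * semiNth P (semiCount P ((n + 1) / i) - 1)) -
        a (semiCount P (n / i)) / (i * semiNth P (semiCount P (n / i) - 1))) := by
  rw [Nat.succ_div]
  split_ifs with hd
  · by_cases hs : InSemi P (n / i + 1)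
    · have e1 := semiNth_semiCount _ hs
      have e2 : n / i + 1 = (n + 1) / i := by rw [Nat.succ_div, if_pos hd]
      have e3 : i * semiNth P (semiCount P (n / i)) = n + 1 := by
        rw [e1, e2, Nat.mul_div_cancel' hd]
      rw [semiCount_succ_of _ hs]
      set K := semiCount P (n / i)
      have e3' : (i : ℝ) * semiNth P K = n + 1 := by exact_mod_cast e3
      have hi' : (i : ℝ) ≠ 0 := by positivity
      have h1 : (semiNth P K : ℝ) ≠ 0 := by exact_mod_cast (semiNth_pos hP hne K).ne'
      have h2 : (semiNth P (K - 1) : ℝ) ≠ 0 := by exact_mod_cast (semiNth_pos hP hne (K - 1)).ne'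
      rw [excess, Nat.add_sub_cancel, ← e3']
      field_simp
      ring
    · rw [semiCount_succ_of_not _ hs]; ring
  · rw [add_zero]; ring

theorem excessSum_sub (hP : ∀ p ∈ P, p.Prime) (hne : P.Nonempty) {a : ℕ → ℕ → ℝ}
    (ha : ∀ i, a i 0 = 0) (n : ℕ) :
    excessSum P a (n + 1) - excessSum P a n =
      (n + 1) * (boundarySum P a (n + 1) - boundarySum P a n) := by
  have h1 : excessSum P a n = ∑ i ∈ (Finset.range (n + 1 + 1)).filter (Cop P),
      excess P (a i) (semiCount P (n / i)) := by
    rw [excessSum, Finset.range_add_one (n := n + 1), Finset.filter_insert]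
    split_ifs
    · rw [Finset.sum_insert (by simp), Nat.div_eq_of_lt (Nat.lt_succ_self n), semiCount_zero hP,
        excess, zero_add]
    · rfl
  have h2 : boundarySum P a n = ∑ i ∈ (Finset.range (n + 1 + 1)).filter (Cop P),
      a i (semiCount P (n / i)) / (i * semiNth P (semiCount P (n / i) - 1)) := by
    rw [boundarySum, Finset.range_add_one (n := n + 1), Finset.filter_insert]
    split_ifs
    · rw [Finset.sum_insert (by simp), Nat.div_eq_of_lt (Nat.lt_succ_self n), semiCount_zero hP,
        ha, zero_div, zero_add]
    · rfl
  rw [h1, h2, excessSum, boundarySum, ← Finset.sum_sub_distrib, ← Finset.sum_sub_distrib,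
    Finset.mul_sum]
  refine Finset.sum_congr rfl fun i hi => ?_
  exact excess_sub_eq hP hne
    (Nat.pos_of_ne_zero ((Finset.mem_filter.1 hi).2.ne_zero hne)) n

theorem exists_neg_mul_le_excessSum (hP : ∀ p ∈ P, p.Prime) (hne : P.Nonempty) {a : ℕ → ℕ → ℝ}
    (ha : ∀ i, a i 0 = 0) (ha' : ∀ i k, 0 ≤ a i k) {ε : ℝ} (hε : 0 < ε) (N : ℕ) :
    ∃ n ≥ N, -(ε * n) ≤ excessSum P a n := by
  refine exists_neg_mul_le_of_diff (G := boundarySum P a) (fun n => ?_) ?_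
    (excessSum_sub hP hne ha) hε N
  · exact Finset.sum_nonneg fun i _ => div_nonneg (ha' _ _) (by positivity)
  · refine Finset.sum_eq_zero fun i _ => ?_
    rw [Nat.zero_div, semiCount_zero hP, excess]

/-- Abel summation: (h_{k+1} - h_k)/ℓ_{k+1} is the difference of consecutive a_k/ℓ_k. The left side
is, up to γ⁻¹, what the strong law produces. -/
theorem sum_excess_eq (hP : ∀ p ∈ P, p.Prime) (hne : P.Nonempty) {a : ℕ → ℝ}
    (ha : a 0 = 0) (M : ℕ) :
    ∑ k ∈ Finset.range M, ((semiNth P k : ℝ)⁻¹ - (semiNth P (k + 1) : ℝ)⁻¹) * excess P a (k + 1) =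
      a M / semiNth P (M - 1) - excess P a M / semiNth P M := by
  induction M with
  | zero => simp [ha, excess]
  | succ M ih =>
    have h1 : (semiNth P M : ℝ) ≠ 0 := by exact_mod_cast (semiNth_pos hP hne M).ne'
    have h2 : (semiNth P (M - 1) : ℝ) ≠ 0 := by exact_mod_cast (semiNth_pos hP hne (M - 1)).ne'
    have h3 : (semiNth P (M + 1) : ℝ) ≠ 0 := by exact_mod_cast (semiNth_pos hP hne (M + 1)).ne'
    rw [Finset.sum_range_succ, ih, Nat.add_sub_cancel]
    have e : excess P a (M + 1) =
      excess P a M + a (M + 1) - (semiNth P M : ℝ) / semiNth P (M - 1) * a M := rfl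
    have e' : (semiNth P M : ℝ)⁻¹ * excess P a (M + 1) =
        excess P a M / semiNth P M + a (M + 1) / semiNth P M - a M / semiNth P (M - 1) := by
      rw [e]; field_simp
    rw [sub_mul, e', div_eq_mul_inv (excess P a (M + 1)) _]
    ring

/-- The solved recurrence. Its last sum is an average with weights ℓ_{j+1} - ℓ_j, which bounds the
excess from below. -/
theorem excess_succ_eq (hP : ∀ p ∈ P, p.Prime) (hne : P.Nonempty) {a : ℕ → ℝ}
    (ha : a 0 = 0) (M : ℕ) :
    excess P a (M + 1) = a (M + 1) -
      ∑ j ∈ Finset.range M, ((semiNth P (j + 1) : ℝ) - semiNth P j) * (a (j + 1) / semiNth P j) := by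
  induction M with
  | zero => simp [excess, ha]
  | succ M ih =>
    have h1 : (semiNth P M : ℝ) ≠ 0 := by exact_mod_cast (semiNth_pos hP hne M).ne'
    rw [excess, ih, Finset.sum_range_succ, Nat.add_sub_cancel]
    field_simp
    ring

/-- The same δ serves all sequences, so the bound survives integration. The hypothesis on `a` is the
logarithm of the upper bounds on t, with B = log m. -/
theorem exists_tendsto_zero_bound_excess (hP : ∀ p ∈ P, p.Prime) (hne : P.Nonempty) (B : ℝ) :
    ∃ δ : ℕ → ℝ, Tendsto δ atTop (𝓝 0) ∧ ∀ a : ℕ → ℝ, a 0 = 0 → (∀ k, 0 ≤ a (k + 1)) →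
      (∀ k, a (k + 1) ≤ B * (semiNth P k * ellTail P (Nat.succPNat k))) → ∀ M,
      a (M + 1) / semiNth P M - excess P a (M + 1) / semiNth P (M + 1) ≤ δ M := by
  have hpos : ∀ k, (0 : ℝ) < semiNth P k := fun k => by exact_mod_cast semiNth_pos hP hne k
  have hmono : ∀ k, (semiNth P k : ℝ) ≤ semiNth P (k + 1) := fun k => by
    exact_mod_cast (semiNth_strictMono hP hne).monotone (Nat.le_succ k)
  set T : ℕ → ℝ := fun k => ellTail P (Nat.succPNat k) with hT
  set g : ℕ → ℝ := fun j => (semiNth P (j + 1) : ℝ) - semiNth P j with hg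
  have hsum : ∀ n, ∑ j ∈ Finset.range n, g j = semiNth P n - 1 := fun n => by
    rw [hg, Finset.sum_range_sub (fun j => (semiNth P j : ℝ)), semiNth_zero hP hne, Nat.cast_one]
  have hg0 : ∀ j, 0 ≤ g j := fun j => sub_nonneg.2 (hmono j)
  have htop : Tendsto (fun n => (semiNth P n : ℝ)) atTop atTop :=
    tendsto_natCast_atTop_atTop.comp (semiNth_strictMono hP hne).tendsto_atTop
  -- Toeplitz averaging: the weights g have divergent total ℓ - 1 and the tails T tend to 0.
  have hlo : (fun j => g j * T j) =o[atTop] g := by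
    have h1 : T =o[atTop] (fun _ => (1 : ℝ)) :=
      (Asymptotics.isLittleO_one_iff ℝ).2 (tendsto_ellTail hP hne)
    simpa using (Asymptotics.isBigO_refl g atTop).mul_isLittleO h1
  have h2 := hlo.sum_range hg0 (by simp only [hsum]; exact tendsto_atTop_add_const_right _ (-1) htop)
  simp only [hsum] at h2
  have h3 : (fun n => ∑ j ∈ Finset.range n, g j * T j) =o[atTop]
      (fun n => (semiNth P (n + 1) : ℝ)) := by
    refine h2.trans_isBigO (Asymptotics.IsBigO.of_bound 1 (Eventually.of_forall fun n => ?_))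
    have h1 : (1 : ℝ) ≤ semiNth P n := by exact_mod_cast semiNth_pos hP hne n
    rw [Real.norm_of_nonneg (by linarith), Real.norm_of_nonneg (hpos _).le]
    linarith [hmono n]
  refine ⟨fun M => B * T M + B * ((∑ j ∈ Finset.range M, g j * T j) / semiNth P (M + 1)), ?_, ?_⟩
  · simpa using ((tendsto_ellTail hP hne).const_mul B).add
      (h3.tendsto_div_nhds_zero.const_mul B)
  · intro a ha0 hapos hale M
    have hb : ∀ k, a (k + 1) / semiNth P k ≤ B * T k := fun k => by
      rw [div_le_iff₀ (hpos k)]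
      linarith [hale k, show B * (semiNth P k * T k) = B * T k * semiNth P k by ring]
    have e1 : -excess P a (M + 1) ≤ B * ∑ j ∈ Finset.range M, g j * T j := by
      rw [excess_succ_eq hP hne ha0, Finset.mul_sum]
      have : ∑ j ∈ Finset.range M, g j * (a (j + 1) / semiNth P j) ≤
          ∑ j ∈ Finset.range M, B * (g j * T j) := Finset.sum_le_sum fun j _ => by
        have := mul_le_mul_of_nonneg_left (hb j) (hg0 j)
        linarith
      linarith [hapos M]
    have e2 : -excess P a (M + 1) / semiNth P (M + 1) ≤
        B * ((∑ j ∈ Finset.range M, g j * T j) / semiNth P (M + 1)) := by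
      rw [← mul_div_assoc]
      exact div_le_div_of_nonneg_right e1 (hpos _).le
    have := hb M
    rw [neg_div] at e2
    linarith

/-- Truncation of `excessSum` at word length `M`. -/
theorem excessSum_le (hP : ∀ p ∈ P, p.Prime) (hne : P.Nonempty) {a : ℕ → ℕ → ℝ} {C : ℝ}
    (hC : 0 ≤ C) (h : ∀ i k, excess P (a i) k ≤ C) (M n : ℕ) :
    excessSum P a n ≤ ∑ k ∈ Finset.range M,
      (∑ i ∈ (Finset.range (n / semiNth P k + 1)).filter (Cop P), excess P (a i) (k + 1) -
        ∑ i ∈ (Finset.range (n / semiNth P (k + 1) + 1)).filter (Cop P), excess P (a i) (k + 1)) +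
      C * (n / semiNth P M) := by
  set s := (Finset.range (n + 1)).filter (Cop P) with hs
  have hfil : ∀ k, (Finset.range (n / semiNth P k + 1)).filter (Cop P) =
      s.filter fun i => k < semiCount P (n / i) := by
    intro k
    ext i
    simp only [hs, Finset.mem_filter, Finset.mem_range, lt_semiCount hP hne, Nat.lt_succ_iff]
    have : Cop P i → (i ≤ n / semiNth P k ↔ semiNth P k ≤ n / i) := fun hi => by
      rw [Nat.le_div_iff_mul_le (semiNth_pos hP hne k),
        Nat.le_div_iff_mul_le (Nat.pos_of_ne_zero (hi.ne_zero hne)), mul_comm]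
    constructor
    · rintro ⟨h1, h2⟩
      exact ⟨⟨h1.trans (Nat.div_le_self _ _), h2⟩, (this h2).1 h1⟩
    · rintro ⟨⟨-, h2⟩, h3⟩
      exact ⟨(this h2).2 h3, h2⟩
  have hcard : C * (s.filter fun i => M < semiCount P (n / i)).card ≤ C * (n / semiNth P M) := by
    refine mul_le_mul_of_nonneg_left ?_ hC
    rw [← hfil]
    refine le_trans ?_ (Nat.cast_div_le (α := ℝ))
    have hsub : (Finset.range (n / semiNth P M + 1)).filter (Cop P) ⊆
        Finset.Icc 1 (n / semiNth P M) := fun i hi => by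
      rw [Finset.mem_filter, Finset.mem_range] at hi
      exact Finset.mem_Icc.2 ⟨Nat.pos_of_ne_zero (hi.2.ne_zero hne), by omega⟩
    have := Finset.card_le_card hsub
    rw [Nat.card_Icc, Nat.add_sub_cancel] at this
    exact_mod_cast this
  refine le_trans ?_ (add_le_add_right hcard _)
  simp only [hfil]
  rw [Finset.card_filter, Nat.cast_sum, Finset.mul_sum]
  simp only [Finset.sum_filter]
  simp only [← Finset.sum_sub_distrib]
  rw [Finset.sum_comm, ← Finset.sum_add_distrib]
  refine Finset.sum_le_sum fun i _ => ?_
  set K := semiCount P (n / i)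
  -- The difference of the two indicators selects the indices i whose word has length exactly k + 1.
  have hterm : ∀ k, ((if k < K then excess P (a i) (k + 1) else 0) -
      if k + 1 < K then excess P (a i) (k + 1) else 0) =
      if k + 1 = K then excess P (a i) K else 0 := by
    intro k
    by_cases h1 : k + 1 = K
    · rw [if_pos (by omega), if_neg (by omega), if_pos h1, h1, sub_zero]
    · rw [if_neg h1]
      by_cases h2 : k < K
      · rw [if_pos h2, if_pos (by omega), sub_self]
      · rw [if_neg h2, if_neg (by omega), sub_self]
  simp only [hterm]
  by_cases hKM : M < K
  · rw [Finset.sum_eq_zero fun k hk => if_neg (by have := Finset.mem_range.1 hk; omega), if_pos hKM]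
    simpa using h i K
  · rw [if_neg hKM, Nat.cast_zero, mul_zero, add_zero]
    rcases Nat.eq_zero_or_pos K with h0 | h0
    · rw [Finset.sum_eq_zero fun k _ => if_neg (by omega), h0, excess]
    · rw [Finset.sum_eq_single (K - 1) (fun k _ hk => if_neg (by omega))
        (fun hk => absurd (Finset.mem_range.2 (by omega)) hk), if_pos (by omega)]

end SequenceBounds

/-! ### Prefixes and existence of a solution -/

section Words

variable {m : ℕ}

theorem SymbolSpace.length_initialWord (y : SymbolSpace m) (k : ℕ) :
    (y.initialWord k).length = k := by simp [SymbolSpace.initialWord]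

theorem SymbolSpace.initialWord_zero (y : SymbolSpace m) : y.initialWord 0 = [] := by
  simp [SymbolSpace.initialWord]

theorem SymbolSpace.initialWord_succ (y : SymbolSpace m) (k : ℕ) :
    y.initialWord (k + 1) = y.initialWord k ++ [y (Nat.succPNat k)] := by
  rw [SymbolSpace.initialWord, List.ofFn_succ_last]
  simp [SymbolSpace.initialWord]

theorem initialWord_mem_Pref {Ω : Set (SymbolSpace m)} {y : SymbolSpace m} (hy : y ∈ Ω) (k : ℕ) :
    y.initialWord k ∈ Pref Ω := ⟨y, hy, by rw [y.length_initialWord]⟩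

theorem nil_mem_Pref {Ω : Set (SymbolSpace m)} (hne : Ω.Nonempty) : [] ∈ Pref Ω := by
  obtain ⟨y, hy⟩ := hne
  exact ⟨y, hy, y.initialWord_zero⟩

theorem exists_child {Ω : Set (SymbolSpace m)} {u : List (Fin m)} (hu : u ∈ Pref Ω) :
    ∃ j, u ++ [j] ∈ Pref Ω := by
  obtain ⟨y, hy, h⟩ := hu
  refine ⟨y (Nat.succPNat u.length), ?_⟩
  have := initialWord_mem_Pref hy (u.length + 1)
  rwa [y.initialWord_succ, h] at this

variable {P : Finset ℕ}

/-- The exponent `γ(S)` at the root and `ℓ_{k+1} / ℓ_k` at words of length `k ≥ 1`. -/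
noncomputable def nodeExp (P : Finset ℕ) : ℕ → ℝ
  | 0 => gammaS P
  | k + 1 => (semiNth P (k + 1) : ℝ) / semiNth P k

/-- The upper bound required of solutions at words of length `k`. -/
noncomputable def nodeBound (m : ℕ) (P : Finset ℕ) : ℕ → ℝ
  | 0 => m
  | k + 1 => (m : ℝ) ^ ((semiNth P k : ℝ) * ellTail P (Nat.succPNat k))

theorem nodeExp_pos (hP : ∀ p ∈ P, p.Prime) (hne : P.Nonempty) (k : ℕ) : 0 < nodeExp P k := by
  cases k with
  | zero => exact lt_of_lt_of_le one_pos (one_le_gammaS hP hne)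
  | succ k =>
    exact div_pos (by exact_mod_cast semiNth_pos hP hne _) (by exact_mod_cast semiNth_pos hP hne _)

theorem one_le_nodeBound (hm : 1 ≤ m) (k : ℕ) : 1 ≤ nodeBound m P k := by
  have h1 : (1 : ℝ) ≤ m := by exact_mod_cast hm
  cases k with
  | zero => exact h1
  | succ k => exact Real.one_le_rpow h1 (mul_nonneg (Nat.cast_nonneg _) (ellTail_nonneg _))

/-- The upper bounds themselves solve the system of the full shift. Hence passing to child sums and
taking roots preserves them. -/
theorem mul_nodeBound_succ (hP : ∀ p ∈ P, p.Prime) (hne : P.Nonempty) (hm : 1 ≤ m) (k : ℕ) :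
    m * nodeBound m P (k + 1) = nodeBound m P k ^ nodeExp P k := by
  have h0 : (0 : ℝ) < m := by exact_mod_cast hm
  have e : (m : ℝ) * nodeBound m P (k + 1) =
      (m : ℝ) ^ (1 + (semiNth P k : ℝ) * ellTail P (Nat.succPNat k)) := by
    rw [Real.rpow_add h0, Real.rpow_one]; rfl
  rw [e]
  cases k with
  | zero => rw [semiNth_zero hP hne, Nat.cast_one, one_mul, ← gammaS_eq_add hP hne]; rfl
  | succ k =>
    have h1 : (semiNth P k : ℝ) ≠ 0 := by exact_mod_cast (semiNth_pos hP hne k).ne'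
    have h2 : (semiNth P (k + 1) : ℝ) ≠ 0 := by exact_mod_cast (semiNth_pos hP hne (k + 1)).ne'
    rw [nodeBound, nodeExp, ← Real.rpow_mul h0.le, ellTail_succ hP hne k]
    congr 1
    field_simp

theorem isTreeSolution_iff (hP : ∀ p ∈ P, p.Prime) (hne : P.Nonempty) {Ω : Set (SymbolSpace m)}
    (hΩ : Ω.Nonempty) {t : List (Fin m) → ℝ} :
    IsTreeSolution P Ω t ↔ ∀ u ∈ Pref Ω, t u ∈ Set.Icc 1 (nodeBound m P u.length) ∧
      t u ^ nodeExp P u.length = childSum Ω t u := by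
  constructor
  · intro h u hu
    rcases hk : u.length with _ | k
    · rw [List.length_eq_zero_iff] at hk
      subst hk
      exact ⟨h.root_mem, h.root_eq⟩
    · have h1 := h.node_mem (Nat.succPNat k) u hu (by simpa using hk)
      have h2 := h.node_eq (Nat.succPNat k) u hu (by simpa using hk)
      rw [show Nat.succPNat k + 1 = Nat.succPNat (k + 1) from rfl, ell_succPNat hP hne,
        ell_succPNat hP hne] at h2
      rw [ell_succPNat hP hne] at h1
      exact ⟨h1, h2⟩
  · intro h
    refine ⟨(h [] (nil_mem_Pref hΩ)).1, ?_, (h [] (nil_mem_Pref hΩ)).2, ?_⟩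
    · intro k u hu hk
      obtain ⟨k, rfl⟩ : ∃ j, k = Nat.succPNat j := ⟨_, (PNat.succPNat_natPred k).symm⟩
      have h1 := (h u hu).1
      rw [hk, Nat.succPNat_coe] at h1
      rw [ell_succPNat hP hne]
      exact h1
    · intro k u hu hk
      obtain ⟨k, rfl⟩ : ∃ j, k = Nat.succPNat j := ⟨_, (PNat.succPNat_natPred k).symm⟩
      have h1 := (h u hu).2
      rw [hk, Nat.succPNat_coe] at h1
      rw [show Nat.succPNat k + 1 = Nat.succPNat (k + 1) from rfl, ell_succPNat hP hne,
        ell_succPNat hP hne]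
      exact h1

theorem one_le_childSum {Ω : Set (SymbolSpace m)} {t : List (Fin m) → ℝ} {u : List (Fin m)}
    (hu : u ∈ Pref Ω) (ht : ∀ v, 1 ≤ t v) : 1 ≤ childSum Ω t u := by
  obtain ⟨j, hj⟩ := exists_child hu
  refine (ht (u ++ [j])).trans ?_
  classical
  exact Finset.single_le_sum (f := fun j => t (u ++ [j]))
    (fun i _ => zero_le_one.trans (ht _)) (Finset.mem_filter.2 ⟨Finset.mem_univ j, hj⟩)

theorem exists_isTreeSolution (hP : ∀ p ∈ P, p.Prime) (hne : P.Nonempty) (hm : 1 ≤ m)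
    {Ω : Set (SymbolSpace m)} (hΩ : Ω.Nonempty) : ∃ t, IsTreeSolution P Ω t := by
  classical
  -- Nonempty intervals: this makes each `Set.Icc`, and so their product, a complete lattice.
  have hfact : ∀ u : List (Fin m), Fact ((1 : ℝ) ≤ nodeBound m P u.length) :=
    fun u => ⟨one_le_nodeBound hm _⟩
  have hmem : ∀ (t : ∀ u : List (Fin m), Set.Icc (1 : ℝ) (nodeBound m P u.length)) u, u ∈ Pref Ω →
      childSum Ω (fun v => t v) u ^ (nodeExp P u.length)⁻¹ ∈
        Set.Icc (1 : ℝ) (nodeBound m P u.length) := by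
    intro t u hu
    have h1 := one_le_childSum hu fun v => (t v).2.1
    have hθ := nodeExp_pos hP hne u.length
    refine ⟨Real.one_le_rpow h1 (inv_nonneg.2 hθ.le), ?_⟩
    rw [Real.rpow_inv_le_iff_of_pos (by linarith)
      (zero_le_one.trans (one_le_nodeBound hm _)) hθ, ← mul_nodeBound_succ hP hne hm]
    refine (Finset.sum_le_sum_of_subset_of_nonneg (Finset.filter_subset _ _)
      fun j _ _ => zero_le_one.trans (t (u ++ [j])).2.1).trans ?_
    refine (Finset.sum_le_sum (g := fun _ => nodeBound m P (u.length + 1)) fun j _ => ?_).trans ?_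
    · exact (t (u ++ [j])).2.2.trans_eq (by rw [List.length_append, List.length_singleton])
    · simp
  let T : (∀ u : List (Fin m), Set.Icc (1 : ℝ) (nodeBound m P u.length)) →o
      (∀ u : List (Fin m), Set.Icc (1 : ℝ) (nodeBound m P u.length)) :=
    { toFun := fun t u => if hu : u ∈ Pref Ω then ⟨_, hmem t u hu⟩ else ⟨1, le_rfl, (hfact u).1⟩
      monotone' := by
        intro s t hst u
        dsimp only
        split_ifs with hu
        · refine Subtype.mk_le_mk.2 (Real.rpow_le_rpow
            (zero_le_one.trans (one_le_childSum hu fun v => (s v).2.1)) ?_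
            (inv_nonneg.2 (nodeExp_pos hP hne _).le))
          exact Finset.sum_le_sum fun j _ => hst (u ++ [j])
        · exact le_rfl }
  refine ⟨fun u => (T.lfp u : ℝ), (isTreeSolution_iff hP hne hΩ).2 fun u hu => ⟨(T.lfp u).2, ?_⟩⟩
  have h : (T.lfp u : ℝ) = childSum Ω (fun v => T.lfp v) u ^ (nodeExp P u.length)⁻¹ := by
    have h1 := congrFun T.map_lfp u
    conv_lhs => rw [← h1]
    change ((if hu : u ∈ Pref Ω then _ else _ : Set.Icc (1 : ℝ) (nodeBound m P u.length)) : ℝ) = _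
    rw [dif_pos hu]
  rw [h, Real.rpow_inv_rpow (zero_le_one.trans (one_le_childSum hu fun v => (T.lfp v).2.1))
    (nodeExp_pos hP hne _).ne']

end Words

/-! ### Cylinders and measurability -/

namespace SymbolSpace

variable {m : ℕ}

noncomputable instance : MeasurableSpace (SymbolSpace m) := borel _

instance : BorelSpace (SymbolSpace m) := ⟨rfl⟩

theorem initialWord_eq_iff {x y : SymbolSpace m} {k : ℕ} :
    x.initialWord k = y.initialWord k ↔ ∀ i < k, x (Nat.succPNat i) = y (Nat.succPNat i) := by
  simp only [initialWord, List.ofFn_inj, funext_iff]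
  exact ⟨fun h i hi => h ⟨i, hi⟩, fun h i => h i i.2⟩

theorem dist_le_of_initialWord_eq {x y : SymbolSpace m} {k : ℕ}
    (h : x.initialWord k = y.initialWord k) : dist x y ≤ ((m : ℝ) ^ (k + 1))⁻¹ := by
  change rho x y ≤ _
  have h1 := one_le_of_elem x
  by_cases hxy : x = y
  · rw [rho, if_pos hxy]; positivity
  · rw [rho, if_neg hxy]
    refine inv_anti₀ (by positivity) (pow_le_pow_right₀ h1 ?_)
    obtain ⟨i, hi, hne⟩ := firstDiff_spec hxy
    rw [← hi]
    by_contra hlt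
    apply hne
    rw [← PNat.succPNat_natPred i]
    refine initialWord_eq_iff.1 h _ ?_
    have := PNat.natPred_add_one i
    omega

theorem initialWord_eq_of_dist_lt {x y : SymbolSpace m} {k : ℕ}
    (h : dist x y < ((m : ℝ) ^ k)⁻¹) : x.initialWord k = y.initialWord k := by
  refine initialWord_eq_iff.2 fun i hi => ?_
  by_contra hne
  have h1 := rho_le_of_ne hne
  have h2 := one_le_of_elem x
  refine absurd (lt_of_le_of_lt h1 h) (not_lt.2 (inv_anti₀ (by positivity)
    (pow_le_pow_right₀ h2 (by rw [Nat.succPNat_coe]; omega))))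

/-- The set of sequences whose initial word of length `k` is `u`. -/
def cyl (k : ℕ) (u : List (Fin m)) : Set (SymbolSpace m) := {y | y.initialWord k = u}

theorem isOpen_cyl (k : ℕ) (u : List (Fin m)) : IsOpen (cyl k u) := by
  rw [Metric.isOpen_iff]
  intro x hx
  have h1 := one_le_of_elem x
  exact ⟨((m : ℝ) ^ k)⁻¹, by positivity, fun y hy =>
    (initialWord_eq_of_dist_lt (Metric.mem_ball.1 hy)).trans hx⟩

theorem measurableSet_cyl (k : ℕ) (u : List (Fin m)) : MeasurableSet (cyl k u) :=
  (isOpen_cyl k u).measurableSet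

theorem exists_inv_pow_lt (hm : 2 ≤ m) {ε : ℝ} (hε : 0 < ε) : ∃ k, ((m : ℝ) ^ (k + 1))⁻¹ < ε := by
  have h1 : (1 : ℝ) < m := by exact_mod_cast hm
  obtain ⟨k, hk⟩ := exists_pow_lt_of_lt_one hε (inv_lt_one_of_one_lt₀ h1)
  refine ⟨k, lt_of_le_of_lt ?_ hk⟩
  rw [inv_pow]
  exact inv_anti₀ (by positivity) (pow_le_pow_right₀ h1.le (Nat.le_succ k))

theorem mem_of_forall_initialWord (hm : 2 ≤ m) {Ω : Set (SymbolSpace m)} (hΩ : IsClosed Ω)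
    {y : SymbolSpace m} (h : ∀ k, y.initialWord k ∈ Pref Ω) : y ∈ Ω := by
  rw [← hΩ.closure_eq, Metric.mem_closure_iff]
  intro ε hε
  obtain ⟨k, hk⟩ := exists_inv_pow_lt hm hε
  obtain ⟨z, hz, hzk⟩ := h k
  rw [length_initialWord] at hzk
  exact ⟨z, hz, (dist_le_of_initialWord_eq hzk.symm).trans_lt hk⟩

/-- There are countably many words, so every open set is a countable union of cylinders. -/
theorem measurable_of_cyl (hm : 2 ≤ m) {α : Type*} [MeasurableSpace α] {f : α → SymbolSpace m}
    (hf : ∀ (z : SymbolSpace m) k, MeasurableSet (f ⁻¹' cyl k (z.initialWord k))) : Measurable f := by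
  have hf' : ∀ k u, MeasurableSet (f ⁻¹' cyl k u) := by
    intro k u
    rcases (cyl k u).eq_empty_or_nonempty with h | ⟨z, hz⟩
    · rw [h, Set.preimage_empty]; exact MeasurableSet.empty
    · rw [← show z.initialWord k = u from hz]; exact hf z k
  refine measurable_of_isOpen fun U hU => ?_
  have : f ⁻¹' U = ⋃ p : ℕ × {q : ℕ × List (Fin m) // cyl q.1 q.2 ⊆ U},
      f ⁻¹' cyl p.2.1.1 p.2.1.2 := by
    ext a
    simp only [Set.mem_iUnion, Set.mem_preimage]
    constructor
    · intro ha
      obtain ⟨ε, hε, hball⟩ := Metric.isOpen_iff.1 hU _ ha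
      obtain ⟨k, hk⟩ := exists_inv_pow_lt hm hε
      refine ⟨⟨0, ⟨(k, (f a).initialWord k), fun y hy => hball ?_⟩⟩, rfl⟩
      exact Metric.mem_ball.2 ((dist_le_of_initialWord_eq hy).trans_lt hk)
    · rintro ⟨p, hp⟩
      exact p.2.2 hp
  rw [this]
  exact MeasurableSet.iUnion fun p => hf' _ _

theorem measurable_comp_initialWord (g : List (Fin m) → ℝ) (k : ℕ) :
    Measurable fun y : SymbolSpace m => g (y.initialWord k) := by
  intro s _
  have : (fun y : SymbolSpace m => g (y.initialWord k)) ⁻¹' s =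
      ⋃ u ∈ {u : List (Fin m) | g u ∈ s}, cyl k u := by
    ext y; simp [cyl]
  rw [this]
  exact MeasurableSet.biUnion (Set.to_countable _) fun u _ => measurableSet_cyl k u

theorem exists_bound_comp_initialWord (g : List (Fin m) → ℝ) (k : ℕ) :
    ∃ C, ∀ y : SymbolSpace m, |g (y.initialWord k)| ≤ C := by
  obtain ⟨C, hC⟩ := ((List.finite_length_eq (Fin m) k).image fun u => |g u|).bddAbove
  exact ⟨C, fun y => hC ⟨_, length_initialWord y k, rfl⟩⟩

end SymbolSpace

/-! ### The random element of Ω as a path through a tree of independent letters -/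

section Path

variable {m : ℕ}

/-- The initial words of the sequence that continues each word `u` with the letter `ω u`. -/
def pathWord (ω : List (Fin m) → Fin m) : ℕ → List (Fin m)
  | 0 => []
  | k + 1 => pathWord ω k ++ [ω (pathWord ω k)]

/-- The sequence that continues each of its initial words `u` with the letter `ω u`. -/
def path (ω : List (Fin m) → Fin m) : SymbolSpace m := fun n => ω (pathWord ω n.natPred)

theorem initialWord_path (ω : List (Fin m) → Fin m) (k : ℕ) :
    (path ω).initialWord k = pathWord ω k := by
  induction k with
  | zero => exact SymbolSpace.initialWord_zero _
  | succ k ih =>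
    rw [SymbolSpace.initialWord_succ, ih, pathWord, path, Nat.natPred_succPNat]

theorem path_mem_cyl_iff (ω : List (Fin m) → Fin m) (z : SymbolSpace m) (k : ℕ) :
    path ω ∈ SymbolSpace.cyl k (z.initialWord k) ↔
      ∀ j < k, ω (z.initialWord j) = z (Nat.succPNat j) := by
  change (path ω).initialWord k = _ ↔ _
  rw [initialWord_path]
  induction k with
  | zero => simp [pathWord, SymbolSpace.initialWord_zero]
  | succ k ih =>
    rw [pathWord, SymbolSpace.initialWord_succ]
    constructor
    · intro h j hj
      obtain ⟨h1, h2⟩ := List.append_inj' h rfl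
      rcases Nat.lt_succ_iff_lt_or_eq.1 hj with hj | rfl
      · exact ih.1 h1 j hj
      · rw [h1] at h2
        exact List.singleton_inj.1 h2
    · intro h
      have h1 := ih.2 fun j hj => h j (hj.trans (Nat.lt_succ_self k))
      rw [h1, h k (Nat.lt_succ_self k)]

theorem measurable_path (hm : 2 ≤ m) : Measurable (path (m := m)) := by
  refine SymbolSpace.measurable_of_cyl hm fun z k => ?_
  have : path ⁻¹' SymbolSpace.cyl k (z.initialWord k) =
      ⋂ j ∈ Finset.range k, {ω | ω (z.initialWord j) = z (Nat.succPNat j)} := by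
    ext ω
    simp [path_mem_cyl_iff]
  rw [this]
  exact Finset.measurableSet_biInter _ fun j _ =>
    (measurable_pi_apply (z.initialWord j)) (measurableSet_singleton _)

/-- The conditional probability of the letter `j` after the word `u`. -/
noncomputable def weight (Ω : Set (SymbolSpace m)) (t : List (Fin m) → ℝ) (u : List (Fin m))
    (j : Fin m) : ℝ :=
  open Classical in
  if u ∈ Pref Ω then (if u ++ [j] ∈ Pref Ω then t (u ++ [j]) else 0) / childSum Ω t u
  else (m : ℝ)⁻¹

/-- The law of the letter after the word `u`. -/
noncomputable def letterLaw (Ω : Set (SymbolSpace m)) (t : List (Fin m) → ℝ) (u : List (Fin m)) :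
    Measure (Fin m) := ∑ j, ENNReal.ofReal (weight Ω t u j) • Measure.dirac j

theorem letterLaw_apply_singleton (Ω : Set (SymbolSpace m)) (t : List (Fin m) → ℝ)
    (u : List (Fin m)) (j : Fin m) :
    letterLaw Ω t u {j} = ENNReal.ofReal (weight Ω t u j) := by
  rw [letterLaw, Measure.finsetSum_apply]
  simp [Set.indicator_apply]

variable {P : Finset ℕ} {Ω : Set (SymbolSpace m)} {t : List (Fin m) → ℝ}

theorem one_le_childSum_of_mem {u : List (Fin m)} (ht : ∀ u ∈ Pref Ω, 1 ≤ t u) (hu : u ∈ Pref Ω) :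
    1 ≤ childSum Ω t u := by
  classical
  have h := one_le_childSum (t := fun v => if v ∈ Pref Ω then t v else 1) hu fun v => by
    split_ifs with hv
    · exact ht v hv
    · exact le_rfl
  refine h.trans_eq (Finset.sum_congr (by congr) fun j hj => if_pos (Finset.mem_filter.1 hj).2)

theorem weight_nonneg (ht : ∀ u ∈ Pref Ω, 1 ≤ t u) (u : List (Fin m)) (j : Fin m) :
    0 ≤ weight Ω t u j := by
  unfold weight
  split_ifs with h1 h2
  · exact div_nonneg (zero_le_one.trans (ht _ h2))
      (zero_le_one.trans (one_le_childSum_of_mem ht h1))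
  · simp
  · positivity

theorem sum_weight (hm : 2 ≤ m) (ht : ∀ u ∈ Pref Ω, 1 ≤ t u) (u : List (Fin m)) :
    ∑ j, weight Ω t u j = 1 := by
  classical
  by_cases hu : u ∈ Pref Ω
  · simp only [weight, if_pos hu]
    rw [← Finset.sum_div, ← Finset.sum_filter]
    have h := one_le_childSum_of_mem ht hu
    have e : ∑ j with u ++ [j] ∈ Pref Ω, t (u ++ [j]) = childSum Ω t u :=
      Finset.sum_congr (by congr) fun _ _ => rfl
    rw [e, div_self (by linarith)]
  · simp only [weight, if_neg hu]
    have : (m : ℝ) ≠ 0 := by positivity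
    simp [this]

/-- This must hold at every word, since the infinite product has a coordinate for each; the uniform
value of `weight` off `Pref Ω` serves this purpose. -/
theorem isProbabilityMeasure_letterLaw (hm : 2 ≤ m) (ht : ∀ u ∈ Pref Ω, 1 ≤ t u)
    (u : List (Fin m)) : IsProbabilityMeasure (letterLaw Ω t u) := by
  constructor
  rw [letterLaw, Measure.finsetSum_apply]
  simp only [Measure.smul_apply, measure_univ, smul_eq_mul, mul_one]
  rw [← ENNReal.ofReal_sum_of_nonneg fun j _ => weight_nonneg ht u j, sum_weight hm ht,
    ENNReal.ofReal_one]

/-- The law of a tree of independent letters. -/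
noncomputable def treeLaw (Ω : Set (SymbolSpace m)) (t : List (Fin m) → ℝ)
    [∀ u, IsProbabilityMeasure (letterLaw Ω t u)] : Measure (List (Fin m) → Fin m) :=
  Measure.infinitePi (letterLaw Ω t)

variable [∀ u, IsProbabilityMeasure (letterLaw Ω t u)]

instance : IsProbabilityMeasure (treeLaw Ω t) := by unfold treeLaw; infer_instance

/-- The letters read along z sit at words of different lengths, hence at distinct coordinates, and
are independent. The path is thus a Markov chain on prefixes. -/
theorem treeLaw_path_mem_cyl (z : SymbolSpace m) (k : ℕ) :
    treeLaw Ω t (path ⁻¹' SymbolSpace.cyl k (z.initialWord k)) =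
      ∏ j ∈ Finset.range k,
        ENNReal.ofReal (weight Ω t (z.initialWord j) (z (Nat.succPNat j))) := by
  have hinj : Set.InjOn z.initialWord (Finset.range k : Set ℕ) := fun i _ j _ h => by
    rw [← z.length_initialWord i, h, z.length_initialWord]
  have : path ⁻¹' SymbolSpace.cyl k (z.initialWord k) =
      Set.pi ((Finset.range k).image z.initialWord : Finset (List (Fin m)))
        (fun u => {z (Nat.succPNat u.length)}) := by
    ext ω
    rw [Set.mem_preimage, path_mem_cyl_iff]
    simp [Set.mem_pi, z.length_initialWord]
  rw [this, treeLaw, Measure.infinitePi_pi _ fun _ _ => measurableSet_singleton _,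
    Finset.prod_image hinj]
  exact Finset.prod_congr rfl fun j _ => by
    rw [letterLaw_apply_singleton, z.length_initialWord]

/-- Letters leaving `Pref Ω` have weight 0 and there are countably many words; a sequence all of
whose prefixes lie in `Pref Ω` belongs to the closed set Ω. -/
theorem ae_path_mem (hm : 2 ≤ m) (hΩ : IsClosed Ω) (hne : Ω.Nonempty) :
    ∀ᵐ ω ∂treeLaw Ω t, path ω ∈ Ω := by
  have h1 : ∀ᵐ ω ∂treeLaw Ω t, ∀ u ∈ Pref Ω, u ++ [ω u] ∈ Pref Ω := by
    rw [ae_all_iff]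
    intro u
    by_cases hu : u ∈ Pref Ω
    · have h2 : ∀ᵐ j ∂letterLaw Ω t u, u ++ [j] ∈ Pref Ω := by
        rw [ae_iff_of_countable]
        intro j hj
        by_contra hcon
        rw [letterLaw_apply_singleton, weight, if_pos hu, if_neg hcon, zero_div,
          ENNReal.ofReal_zero] at hj
        exact hj rfl
      filter_upwards [(measurePreserving_eval_infinitePi (letterLaw Ω t) u).quasiMeasurePreserving.ae
        h2] with ω hω _ using hω
    · exact Eventually.of_forall fun ω h => absurd h hu
  filter_upwards [h1] with ω hω
  refine SymbolSpace.mem_of_forall_initialWord hm hΩ fun k => ?_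
  rw [initialWord_path]
  induction k with
  | zero => exact nil_mem_Pref hne
  | succ k ih => exact hω _ ih

end Path

/-! ### Logarithms of t along a sequence -/

section NodeLog

variable {m : ℕ} {P : Finset ℕ} {Ω : Set (SymbolSpace m)} {t : List (Fin m) → ℝ}

/-- The logarithm of `t` at a word, made `0` at the empty word and outside `Pref Ω`. -/
noncomputable def wordLog (Ω : Set (SymbolSpace m)) (t : List (Fin m) → ℝ) (u : List (Fin m)) : ℝ :=
  open Classical in if u ≠ [] ∧ u ∈ Pref Ω then Real.log (t u) else 0

/-- `wordLog` along the initial words of a sequence. -/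
noncomputable def nodeLog (Ω : Set (SymbolSpace m)) (t : List (Fin m) → ℝ) (y : SymbolSpace m)
    (k : ℕ) : ℝ := wordLog Ω t (y.initialWord k)

theorem nodeLog_zero (y : SymbolSpace m) : nodeLog Ω t y 0 = 0 := by
  rw [nodeLog, y.initialWord_zero, wordLog, if_neg (by simp)]

theorem wordLog_nonneg (ht : ∀ u ∈ Pref Ω, 1 ≤ t u) (u : List (Fin m)) : 0 ≤ wordLog Ω t u := by
  unfold wordLog
  split_ifs with h
  · exact Real.log_nonneg (ht u h.2)
  · exact le_rfl

theorem nodeLog_succ_of_mem {y : SymbolSpace m} (hy : y ∈ Ω) (k : ℕ) :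
    nodeLog Ω t y (k + 1) = Real.log (t (y.initialWord (k + 1))) := by
  have h : y.initialWord (k + 1) ≠ [] := by
    rw [y.initialWord_succ]
    simp
  rw [nodeLog, wordLog, if_pos ⟨h, initialWord_mem_Pref hy _⟩]

/-- Thanks to the value 0 off `Pref Ω` no membership in Ω is needed, so later estimates hold for
every path and not just almost surely. -/
theorem nodeLog_succ_le (hm : 1 ≤ m) (ht : ∀ u ∈ Pref Ω, t u ∈ Set.Icc 1 (nodeBound m P u.length))
    (y : SymbolSpace m) (k : ℕ) :
    nodeLog Ω t y (k + 1) ≤ Real.log m * (semiNth P k * ellTail P (Nat.succPNat k)) := by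
  have h1 : (1 : ℝ) ≤ m := by exact_mod_cast hm
  have h2 : 0 ≤ ellTail P (Nat.succPNat k) := ellTail_nonneg _
  unfold nodeLog wordLog
  split_ifs with h
  · have h3 := ht _ h.2
    rw [y.length_initialWord] at h3
    refine (Real.log_le_log (by linarith [h3.1]) h3.2).trans_eq ?_
    rw [nodeBound, Real.log_rpow (by linarith), mul_comm]
  · exact mul_nonneg (Real.log_nonneg h1) (by positivity)

/-- The system turns each child sum into a power of t(u), so log weights are the increments of
`excess`. Since `nodeLog` vanishes at the empty word, the root term γ log t(∅) stands apart. -/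
theorem prod_weight_eq (ht : ∀ u ∈ Pref Ω, 1 ≤ t u)
    (heq : ∀ u ∈ Pref Ω, t u ^ nodeExp P u.length = childSum Ω t u)
    {y : SymbolSpace m} (hy : y ∈ Ω) (K : ℕ) :
    ∏ j ∈ Finset.range (K + 1), weight Ω t (y.initialWord j) (y (Nat.succPNat j)) =
      Real.exp (excess P (nodeLog Ω t y) (K + 1) - gammaS P * Real.log (t [])) := by
  have hw : ∀ j, weight Ω t (y.initialWord j) (y (Nat.succPNat j)) =
      Real.exp (Real.log (t (y.initialWord (j + 1))) -
        nodeExp P j * Real.log (t (y.initialWord j))) := by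
    intro j
    have h1 := initialWord_mem_Pref hy j
    have h2 := initialWord_mem_Pref hy (j + 1)
    have p1 : 0 < t (y.initialWord j) := by linarith [ht _ h1]
    have p2 : 0 < t (y.initialWord (j + 1)) := by linarith [ht _ h2]
    have h3 := heq _ h1
    rw [y.length_initialWord] at h3
    rw [weight, if_pos h1, ← y.initialWord_succ, if_pos h2, ← h3, Real.exp_sub, Real.exp_log p2,
      Real.rpow_def_of_pos p1, mul_comm (nodeExp P j)]
  induction K with
  | zero =>
    rw [Finset.prod_range_one, hw, excess, excess, nodeLog_zero, nodeLog_succ_of_mem hy,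
      y.initialWord_zero]
    simp [nodeExp]
  | succ K ih =>
    have e : excess P (nodeLog Ω t y) (K + 1 + 1) = excess P (nodeLog Ω t y) (K + 1) +
        nodeLog Ω t y (K + 1 + 1) -
          (semiNth P (K + 1) : ℝ) / semiNth P K * nodeLog Ω t y (K + 1) := rfl
    rw [Finset.prod_range_succ, ih, hw, ← Real.exp_add, e, nodeLog_succ_of_mem hy,
      nodeLog_succ_of_mem hy, nodeExp]
    congr 1
    ring

theorem gammaS_mul_log_nonneg (hP : ∀ p ∈ P, p.Prime) (hne : P.Nonempty) (hΩ : Ω.Nonempty)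
    (ht : ∀ u ∈ Pref Ω, 1 ≤ t u) : 0 ≤ gammaS P * Real.log (t []) :=
  mul_nonneg (zero_le_one.trans (one_le_gammaS hP hne)) (Real.log_nonneg (ht _ (nil_mem_Pref hΩ)))

theorem weight_le_one (hm : 2 ≤ m) (ht : ∀ u ∈ Pref Ω, 1 ≤ t u) (u : List (Fin m)) (j : Fin m) :
    weight Ω t u j ≤ 1 := by
  rw [← sum_weight hm ht u]
  exact Finset.single_le_sum (f := weight Ω t u) (fun i _ => weight_nonneg ht u i)
    (Finset.mem_univ j)

/-- A probability is at most 1. -/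
theorem excess_nodeLog_le (hP : ∀ p ∈ P, p.Prime) (hne : P.Nonempty) (hm : 2 ≤ m)
    (ht : ∀ u ∈ Pref Ω, 1 ≤ t u)
    (heq : ∀ u ∈ Pref Ω, t u ^ nodeExp P u.length = childSum Ω t u)
    {y : SymbolSpace m} (hy : y ∈ Ω) (k : ℕ) :
    excess P (nodeLog Ω t y) k ≤ gammaS P * Real.log (t []) := by
  cases k with
  | zero => exact gammaS_mul_log_nonneg hP hne ⟨y, hy⟩ ht
  | succ k =>
    have h := prod_weight_eq ht heq hy k
    have h1 := Finset.prod_le_one (s := Finset.range (k + 1))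
      (fun j _ => weight_nonneg ht (y.initialWord j) (y (Nat.succPNat j)))
      (fun j _ => weight_le_one hm ht (y.initialWord j) (y (Nat.succPNat j)))
    rw [h, Real.exp_le_one_iff] at h1
    linarith

theorem integrable_nodeLog {α : Type*} [MeasurableSpace α] {μ : Measure α} [IsFiniteMeasure μ]
    {f : α → SymbolSpace m} (hf : Measurable f) (k : ℕ) :
    Integrable (fun a => nodeLog Ω t (f a) k) μ := by
  obtain ⟨C, hC⟩ := SymbolSpace.exists_bound_comp_initialWord (wordLog Ω t) k
  exact Integrable.of_bound
    ((SymbolSpace.measurable_comp_initialWord (wordLog Ω t) k).comp hf).aestronglyMeasurable C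
    (Eventually.of_forall fun a => hC (f a))

theorem measurable_excess (k : ℕ) :
    Measurable fun y : SymbolSpace m => excess P (nodeLog Ω t y) k := by
  induction k with
  | zero => exact measurable_const
  | succ k ih =>
    simp only [excess]
    exact (ih.add (SymbolSpace.measurable_comp_initialWord (wordLog Ω t) _)).sub
      ((SymbolSpace.measurable_comp_initialWord (wordLog Ω t) _).const_mul _)

theorem integrable_excess {α : Type*} [MeasurableSpace α] {μ : Measure α} [IsFiniteMeasure μ]
    {f : α → SymbolSpace m} (hf : Measurable f) (k : ℕ) :
    Integrable (fun a => excess P (nodeLog Ω t (f a)) k) μ := by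
  induction k with
  | zero => exact integrable_zero _ _ _
  | succ k ih =>
    simp only [excess]
    exact (ih.add (integrable_nodeLog hf _)).sub ((integrable_nodeLog hf _).const_mul _)

end NodeLog

/-! ### Assembling one sequence from independent paths along the sets iS -/

section Weave

variable {m : ℕ} {P : Finset ℕ}

/-- The part of `r` prime to `P` and the index of the complementary factor in the semigroup. -/
noncomputable def splitIndex (P : Finset ℕ) (r : ℕ) : ℕ × ℕ :=
  open Classical in
  if h : ∃ q : ℕ × ℕ, Cop P q.1 ∧ q.1 * semiNth P q.2 = r then h.choose else (0, 0)

theorem splitIndex_mul (hP : ∀ p ∈ P, p.Prime) (hne : P.Nonempty) {i k : ℕ}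
    (hi : Cop P i) : splitIndex P (i * semiNth P k) = (i, k) := by
  have h : ∃ q : ℕ × ℕ, Cop P q.1 ∧ q.1 * semiNth P q.2 = i * semiNth P k := ⟨(i, k), hi, rfl⟩
  rw [splitIndex, dif_pos h]
  have h1 := cop_mul_semi_unique hP h.choose_spec.1 hi (semiNth_mem hP hne _)
    (semiNth_mem hP hne _) h.choose_spec.2
  exact Prod.ext h1.1 ((semiNth_strictMono hP hne).injective h1.2)

/-- The sequence whose restriction to `i S` is the path of the `i`-th tree. -/
noncomputable def weave (P : Finset ℕ) (ω : ℕ → List (Fin m) → Fin m) : SymbolSpace m :=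
  fun r => path (ω (splitIndex P r).1) (Nat.succPNat (splitIndex P r).2)

/-- `x|_{iS}` for a natural number `i`. -/
noncomputable def restr (P : Finset ℕ) (x : SymbolSpace m) (i : ℕ) : SymbolSpace m :=
  restrictTo P (Nat.toPNat' i) x

theorem toPNat'_mul_ell (hP : ∀ p ∈ P, p.Prime) (hne : P.Nonempty) {i : ℕ} (hi : Cop P i)
    (k : ℕ) : ((Nat.toPNat' i * ell P (Nat.succPNat k) : ℕ+) : ℕ) = i * semiNth P k := by
  rw [PNat.mul_coe, ell_succPNat hP hne, Nat.toPNat'_coe,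
    if_pos (Nat.pos_of_ne_zero (hi.ne_zero hne))]

theorem restr_weave (hP : ∀ p ∈ P, p.Prime) (hne : P.Nonempty)
    (ω : ℕ → List (Fin m) → Fin m) {i : ℕ} (hi : Cop P i) :
    restr P (weave P ω) i = path (ω i) := by
  funext k
  obtain ⟨k, rfl⟩ : ∃ j, k = Nat.succPNat j := ⟨_, (PNat.succPNat_natPred k).symm⟩
  rw [restr, restrictTo, weave, toPNat'_mul_ell hP hne hi, splitIndex_mul hP hne hi]

theorem mem_multSet_iff {Ω : Set (SymbolSpace m)} {x : SymbolSpace m} (hne : P.Nonempty) :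
    x ∈ multSet P Ω ↔ ∀ i, Cop P i → restr P x i ∈ Ω := by
  constructor
  · intro h i hi
    refine h _ fun p hp => ?_
    rw [Nat.toPNat'_coe, if_pos (Nat.pos_of_ne_zero (hi.ne_zero hne))]
    exact hi p hp
  · intro h i hi
    have := h i hi
    rwa [restr, PNat.coe_toPNat'] at this

/-- The positions 1, …, n split into the sets iS ∩ [1, n], and the one for i consists of the first
`semiCount P (n / i)` terms of iS. -/
theorem initialWord_eq_iff_restr (hP : ∀ p ∈ P, p.Prime) (hne : P.Nonempty)
    (x z : SymbolSpace m) (n : ℕ) :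
    x.initialWord n = z.initialWord n ↔ ∀ i ∈ (Finset.range (n + 1)).filter (Cop P),
      (restr P x i).initialWord (semiCount P (n / i)) =
        (restr P z i).initialWord (semiCount P (n / i)) := by
  simp only [SymbolSpace.initialWord_eq_iff, lt_semiCount hP hne, Finset.mem_filter,
    Finset.mem_range]
  constructor
  · rintro h i ⟨-, hi⟩ k hk
    rw [Nat.le_div_iff_mul_le (Nat.pos_of_ne_zero (hi.ne_zero hne))] at hk
    have e := toPNat'_mul_ell hP hne hi k
    have e2 : Nat.toPNat' i * ell P (Nat.succPNat k) =
        Nat.succPNat (Nat.toPNat' i * ell P (Nat.succPNat k)).natPred :=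
      (PNat.succPNat_natPred _).symm
    have e3 := PNat.natPred_add_one (Nat.toPNat' i * ell P (Nat.succPNat k))
    rw [restr, restr, restrictTo, restrictTo, e2]
    refine h _ ?_
    rw [mul_comm] at hk
    omega
  · intro h r hr
    obtain ⟨i, s, hi, hs, his⟩ := exists_cop_mul_semi hP (Nat.succ_pos r)
    obtain ⟨k, rfl⟩ := exists_semiNth hs
    have hi0 := Nat.pos_of_ne_zero (hi.ne_zero hne)
    have hs0 := semiNth_pos hP hne k
    have h1 : i ≤ n := by
      have := Nat.le_mul_of_pos_right i hs0
      omega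
    have h2 := h i ⟨by omega, hi⟩ k (by
      rw [Nat.le_div_iff_mul_le hi0, mul_comm]; omega)
    have e : Nat.toPNat' i * ell P (Nat.succPNat k) = Nat.succPNat r := by
      apply PNat.eq
      rw [toPNat'_mul_ell hP hne hi, his, Nat.succPNat_coe]
    rwa [restr, restr, restrictTo, restrictTo, e] at h2

theorem weave_mem_cyl_iff (hP : ∀ p ∈ P, p.Prime) (hne : P.Nonempty)
    (z : SymbolSpace m) (n : ℕ) :
    weave P ⁻¹' SymbolSpace.cyl n (z.initialWord n) =
      Set.pi ((Finset.range (n + 1)).filter (Cop P) : Finset ℕ) (fun i =>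
        path ⁻¹' SymbolSpace.cyl (semiCount P (n / i))
          ((restr P z i).initialWord (semiCount P (n / i)))) := by
  ext ω
  rw [Set.mem_preimage, Set.mem_pi]
  change (weave P ω).initialWord n = _ ↔ _
  rw [initialWord_eq_iff_restr hP hne]
  refine forall₂_congr fun i hi => ?_
  rw [restr_weave hP hne ω (Finset.mem_filter.1 hi).2]
  rfl

theorem measurable_weave (hP : ∀ p ∈ P, p.Prime) (hne : P.Nonempty) (hm : 2 ≤ m) :
    Measurable (weave (m := m) P) := by
  refine SymbolSpace.measurable_of_cyl hm fun z n => ?_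
  rw [weave_mem_cyl_iff hP hne]
  exact MeasurableSet.pi (Finset.countable_toSet _) fun i _ =>
    measurable_path hm (SymbolSpace.measurableSet_cyl _ _)

variable {Ω : Set (SymbolSpace m)} {t : List (Fin m) → ℝ}
  [∀ u, IsProbabilityMeasure (letterLaw Ω t u)]

/-- The law of a sequence of independent trees. -/
noncomputable def forestLaw (Ω : Set (SymbolSpace m)) (t : List (Fin m) → ℝ)
    [∀ u, IsProbabilityMeasure (letterLaw Ω t u)] : Measure (ℕ → List (Fin m) → Fin m) :=
  Measure.infinitePi fun _ => treeLaw Ω t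

instance : IsProbabilityMeasure (forestLaw Ω t) := by unfold forestLaw; infer_instance

theorem ae_path_forest_mem (hm : 2 ≤ m) (hΩ : IsClosed Ω) (hΩne : Ω.Nonempty) :
    ∀ᵐ ω ∂forestLaw Ω t, ∀ i, path (ω i) ∈ Ω := by
  rw [ae_all_iff]
  intro i
  exact (measurePreserving_eval_infinitePi (fun _ : ℕ => treeLaw Ω t) i).quasiMeasurePreserving.ae
    (ae_path_mem hm hΩ hΩne)

theorem weave_mem_multSet (hP : ∀ p ∈ P, p.Prime) (hne : P.Nonempty)
    {ω : ℕ → List (Fin m) → Fin m} (h : ∀ i, path (ω i) ∈ Ω) : weave P ω ∈ multSet P Ω :=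
  (mem_multSet_iff hne).2 fun i hi => by rw [restr_weave hP hne ω hi]; exact h i

theorem forestLaw_weave_cyl (hP : ∀ p ∈ P, p.Prime) (hne : P.Nonempty) (hm : 2 ≤ m)
    (ht : ∀ u ∈ Pref Ω, 1 ≤ t u)
    (heq : ∀ u ∈ Pref Ω, t u ^ nodeExp P u.length = childSum Ω t u)
    {z : SymbolSpace m} (hz : z ∈ multSet P Ω) (n : ℕ) :
    forestLaw Ω t (weave P ⁻¹' SymbolSpace.cyl n (z.initialWord n)) =
      ENNReal.ofReal (Real.exp (excessSum P (fun i => nodeLog Ω t (restr P z i)) n -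
        gammaS P * Real.log (t []) * copCount P n)) := by
  rw [weave_mem_cyl_iff hP hne, forestLaw, Measure.infinitePi_pi _ fun i _ =>
    measurable_path hm (SymbolSpace.measurableSet_cyl _ _)]
  have hterm : ∀ i ∈ (Finset.range (n + 1)).filter (Cop P),
      treeLaw Ω t (path ⁻¹' SymbolSpace.cyl (semiCount P (n / i))
          ((restr P z i).initialWord (semiCount P (n / i)))) =
        ENNReal.ofReal (Real.exp (excess P (nodeLog Ω t (restr P z i)) (semiCount P (n / i)) -
          gammaS P * Real.log (t []))) := by
    intro i hi
    rw [Finset.mem_filter, Finset.mem_range] at hi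
    have hi0 := Nat.pos_of_ne_zero (hi.2.ne_zero hne)
    have hK : 0 < semiCount P (n / i) := by
      rw [lt_semiCount hP hne, semiNth_zero hP hne]
      exact Nat.div_pos (by omega) hi0
    obtain ⟨K, hK'⟩ := Nat.exists_eq_succ_of_ne_zero hK.ne'
    rw [hK', treeLaw_path_mem_cyl, ← ENNReal.ofReal_prod_of_nonneg fun j _ => weight_nonneg ht _ _,
      prod_weight_eq ht heq ((mem_multSet_iff hne).1 hz i hi.2)]
  rw [Finset.prod_congr rfl hterm, ← ENNReal.ofReal_prod_of_nonneg fun _ _ => (Real.exp_pos _).le,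
    ← Real.exp_sum, Finset.sum_sub_distrib, Finset.sum_const, nsmul_eq_mul, excessSum, copCount,
    Nat.count_eq_card_filter_range, mul_comm]

end Weave

/-! ### The almost sure upper bound for the excess sum -/

section StrongLaw

variable {m : ℕ} {P : Finset ℕ} {Ω : Set (SymbolSpace m)} {t : List (Fin m) → ℝ}
  [∀ u, IsProbabilityMeasure (letterLaw Ω t u)]

/-- The strong law along the enumeration of the integers prime to `P`, multiplied by their density
1/γ. -/
theorem ae_tendsto_sum_cop (hP : ∀ p ∈ P, p.Prime) (hne : P.Nonempty)
    {g : (List (Fin m) → Fin m) → ℝ} (hg : Measurable g) (hgi : Integrable g (treeLaw Ω t)) :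
    ∀ᵐ ω ∂forestLaw Ω t, Tendsto
      (fun n : ℕ => (∑ i ∈ (Finset.range (n + 1)).filter (Cop P), g (ω i)) / n) atTop
      (𝓝 ((gammaS P)⁻¹ * ∫ τ, g τ ∂treeLaw Ω t)) := by
  set c : ℕ → ℕ := Nat.nth (Cop P) with hc
  have hcinj : Function.Injective c := Nat.nth_injective (cop_infinite hP)
  have hmp : ∀ i, MeasurePreserving (Function.eval i) (forestLaw Ω t) (treeLaw Ω t) := fun i =>
    measurePreserving_eval_infinitePi (fun _ : ℕ => treeLaw Ω t) i
  have hind : iIndepFun (fun j (ω : ℕ → List (Fin m) → Fin m) => g (ω (c j))) (forestLaw Ω t) :=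
    (iIndepFun_infinitePi (P := fun _ : ℕ => treeLaw Ω t) (X := fun _ => g)
      fun _ => hg).precomp hcinj
  have hint : Integrable (fun ω : ℕ → List (Fin m) → Fin m => g (ω (c 0))) (forestLaw Ω t) :=
    (hmp (c 0)).integrable_comp_of_integrable hgi
  have hid : ∀ j, IdentDistrib (fun ω : ℕ → List (Fin m) → Fin m => g (ω (c j)))
      (fun ω => g (ω (c 0))) (forestLaw Ω t) (forestLaw Ω t) := fun j =>
    IdentDistrib.comp (f := fun ω : ℕ → List (Fin m) → Fin m => ω (c j))
      (g := fun ω : ℕ → List (Fin m) → Fin m => ω (c 0))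
      ⟨(hmp (c j)).measurable.aemeasurable, (hmp (c 0)).measurable.aemeasurable,
        (hmp (c j)).map_eq.trans (hmp (c 0)).map_eq.symm⟩ hg
  have hE : ∫ ω, g (ω (c 0)) ∂forestLaw Ω t = ∫ τ, g τ ∂treeLaw Ω t := by
    rw [← (hmp (c 0)).map_eq]
    exact (integral_map (hmp (c 0)).measurable.aemeasurable hg.aestronglyMeasurable).symm
  have hslln := strong_law_ae_real (fun j (ω : ℕ → List (Fin m) → Fin m) => g (ω (c j)))
    hint (fun i j hij => hind.indepFun hij) hid
  have hcount : Tendsto (copCount P) atTop atTop := by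
    refine tendsto_atTop_mono (fun n => Nat.count_monotone _ (Nat.le_succ n)) ?_
    refine tendsto_atTop_atTop_of_monotone (Nat.count_monotone _) fun b => ⟨c b, ?_⟩
    rw [hc, Nat.count_nth_of_infinite (cop_infinite hP)]
  filter_upwards [hslln] with ω hω
  rw [hE] at hω
  have h1 := (tendsto_copCount_div hP hne).mul (hω.comp hcount)
  refine h1.congr' ?_
  filter_upwards [hcount.eventually_gt_atTop 0] with n hn
  have hn' : (copCount P n : ℝ) ≠ 0 := by exact_mod_cast hn.ne'
  rw [sum_filter_range_eq_sum_nth (Cop P) (fun i => g (ω i))]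
  simp only [Function.comp_apply]
  change _ = (∑ j ∈ Finset.range (copCount P n), g (ω (c j))) / n
  field_simp

theorem tendsto_natDiv_div {e : ℕ} (he : 0 < e) :
    Tendsto (fun n : ℕ => ((n / e : ℕ) : ℝ) / n) atTop (𝓝 (e : ℝ)⁻¹) := by
  have h := (tendsto_nat_floor_mul_div_atTop (R := ℝ) (a := (e : ℝ)⁻¹) (by positivity)).comp
    tendsto_natCast_atTop_atTop
  refine h.congr fun n => ?_
  simp only [Function.comp_apply]
  rw [inv_mul_eq_div, Nat.floor_div_eq_div]

theorem ae_eventually_excessSum_le (hP : ∀ p ∈ P, p.Prime) (hne : P.Nonempty) (hm : 2 ≤ m)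
    (hΩ : IsClosed Ω) (hΩne : Ω.Nonempty)
    (ht : ∀ u ∈ Pref Ω, t u ∈ Set.Icc 1 (nodeBound m P u.length))
    (heq : ∀ u ∈ Pref Ω, t u ^ nodeExp P u.length = childSum Ω t u) {ε : ℝ} (hε : 0 < ε) :
    ∀ᵐ ω ∂forestLaw Ω t, ∀ᶠ n in atTop,
      excessSum P (fun i => nodeLog Ω t (path (ω i))) n ≤ ε * n := by
  have ht1 : ∀ u ∈ Pref Ω, 1 ≤ t u := fun u hu => (ht u hu).1
  set C := gammaS P * Real.log (t []) with hC
  have hC0 : 0 ≤ C := gammaS_mul_log_nonneg hP hne hΩne ht1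
  have hγ : 0 < gammaS P := zero_lt_one.trans_le (one_le_gammaS hP hne)
  have hpos : ∀ k, 0 < semiNth P k := semiNth_pos hP hne
  obtain ⟨δ, hδ, hδb⟩ := exists_tendsto_zero_bound_excess hP hne (Real.log m)
  have htop : Tendsto (fun n => (semiNth P n : ℝ)) atTop atTop :=
    tendsto_natCast_atTop_atTop.comp (semiNth_strictMono hP hne).tendsto_atTop
  -- The two terms are the limiting mean of the words of length at most M + 1 and the cost of the
  -- longer ones.
  obtain ⟨M, hM⟩ : ∃ M, (gammaS P)⁻¹ * δ M + C * (semiNth P (M + 1) : ℝ)⁻¹ < ε := by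
    have h : Tendsto (fun M => (gammaS P)⁻¹ * δ M + C * (semiNth P (M + 1) : ℝ)⁻¹) atTop (𝓝 0) := by
      simpa using (hδ.const_mul (gammaS P)⁻¹).add
        ((htop.comp (tendsto_add_atTop_nat 1)).inv_tendsto_atTop.const_mul C)
    exact (h.eventually_lt_const hε).exists
  have hslln : ∀ᵐ ω ∂forestLaw Ω t, ∀ k, Tendsto
      (fun n : ℕ => (∑ i ∈ (Finset.range (n + 1)).filter (Cop P),
        excess P (nodeLog Ω t (path (ω i))) (k + 1)) / n) atTop
      (𝓝 ((gammaS P)⁻¹ * ∫ τ, excess P (nodeLog Ω t (path τ)) (k + 1) ∂treeLaw Ω t)) := by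
    rw [ae_all_iff]
    intro k
    exact ae_tendsto_sum_cop hP hne ((measurable_excess (k + 1)).comp (measurable_path hm))
      (integrable_excess (measurable_path hm) (k + 1))
  filter_upwards [hslln, ae_path_forest_mem hm hΩ hΩne] with ω hω hmem
  set S : ℕ → ℕ → ℝ := fun k n => ∑ i ∈ (Finset.range (n + 1)).filter (Cop P),
    excess P (nodeLog Ω t (path (ω i))) (k + 1) with hS
  set E : ℕ → ℝ := fun k => ∫ τ, excess P (nodeLog Ω t (path τ)) (k + 1) ∂treeLaw Ω t with hE
  have hsc : ∀ k j, Tendsto (fun n : ℕ => S k (n / semiNth P j) / n) atTop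
      (𝓝 ((gammaS P)⁻¹ * E k * (semiNth P j : ℝ)⁻¹)) := by
    intro k j
    have hd : Tendsto (fun n => n / semiNth P j) atTop atTop :=
      Nat.tendsto_div_const_atTop (hpos j).ne'
    refine (((hω k).comp hd).mul (tendsto_natDiv_div (hpos j))).congr' ?_
    filter_upwards [hd.eventually_gt_atTop 0] with n hn
    have : ((n / semiNth P j : ℕ) : ℝ) ≠ 0 := by exact_mod_cast hn.ne'
    simp only [Function.comp_apply, hS]
    field_simp
  have hlim : Tendsto (fun n : ℕ => (∑ k ∈ Finset.range (M + 1),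
      (S k (n / semiNth P k) / n - S k (n / semiNth P (k + 1)) / n)) +
        C * (semiNth P (M + 1) : ℝ)⁻¹) atTop
      (𝓝 ((∑ k ∈ Finset.range (M + 1), ((gammaS P)⁻¹ * E k * (semiNth P k : ℝ)⁻¹ -
        (gammaS P)⁻¹ * E k * (semiNth P (k + 1) : ℝ)⁻¹)) + C * (semiNth P (M + 1) : ℝ)⁻¹)) :=
    (tendsto_finsetSum _ fun k _ => (hsc k k).sub (hsc k (k + 1))).add_const _
  have hval : (∑ k ∈ Finset.range (M + 1), ((gammaS P)⁻¹ * E k * (semiNth P k : ℝ)⁻¹ -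
        (gammaS P)⁻¹ * E k * (semiNth P (k + 1) : ℝ)⁻¹)) ≤ (gammaS P)⁻¹ * δ M := by
    have e1 : (∑ k ∈ Finset.range (M + 1), ((gammaS P)⁻¹ * E k * (semiNth P k : ℝ)⁻¹ -
        (gammaS P)⁻¹ * E k * (semiNth P (k + 1) : ℝ)⁻¹)) = (gammaS P)⁻¹ *
        ∫ τ, ∑ k ∈ Finset.range (M + 1), ((semiNth P k : ℝ)⁻¹ - (semiNth P (k + 1) : ℝ)⁻¹) *
          excess P (nodeLog Ω t (path τ)) (k + 1) ∂treeLaw Ω t := by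
      rw [integral_finsetSum _ fun k _ =>
        (integrable_excess (measurable_path hm) (k + 1)).const_mul _, Finset.mul_sum]
      refine Finset.sum_congr rfl fun k _ => ?_
      rw [integral_const_mul]
      ring
    rw [e1]
    refine mul_le_mul_of_nonneg_left ?_ (inv_nonneg.2 hγ.le)
    have h2 : ∀ τ : List (Fin m) → Fin m, ∑ k ∈ Finset.range (M + 1),
        ((semiNth P k : ℝ)⁻¹ - (semiNth P (k + 1) : ℝ)⁻¹) *
          excess P (nodeLog Ω t (path τ)) (k + 1) ≤ δ M := fun τ => by
      rw [sum_excess_eq hP hne (nodeLog_zero _)]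
      exact hδb _ (nodeLog_zero _) (fun k => wordLog_nonneg ht1 _)
        (nodeLog_succ_le (by omega) ht _) M
    refine (integral_mono (integrable_finsetSum _ fun k _ =>
        (integrable_excess (measurable_path hm) (k + 1)).const_mul _)
        (integrable_const (δ M)) h2).trans_eq ?_
    simp
  filter_upwards [hlim.eventually_lt_const (by linarith : _ < ε), eventually_gt_atTop 0]
    with n hn hn0
  have hn0' : (0 : ℝ) < n := by exact_mod_cast hn0
  have hle := excessSum_le hP hne (a := fun i => nodeLog Ω t (path (ω i))) hC0
    (fun i k => excess_nodeLog_le hP hne hm ht1 heq (hmem i) k) (M + 1) n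
  refine hle.trans ?_
  have h3 := mul_le_mul_of_nonneg_right hn.le hn0'.le
  refine le_trans (le_of_eq ?_) h3
  rw [add_mul, Finset.sum_mul]
  congr 1
  · refine Finset.sum_congr rfl fun k _ => ?_
    rw [sub_mul, div_mul_cancel₀ _ hn0'.ne', div_mul_cancel₀ _ hn0'.ne']
  · ring

end StrongLaw

/-! ### The mass distribution principle for cylinders -/

section Hausdorff

open SymbolSpace

variable {m : ℕ}

theorem SymbolSpace.take_initialWord (y : SymbolSpace m) {j n : ℕ} (h : j ≤ n) :
    (y.initialWord n).take j = y.initialWord j := by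
  induction n, h using Nat.le_induction with
  | base => rw [List.take_of_length_le (y.length_initialWord j).le]
  | succ n h ih =>
    rw [y.initialWord_succ, List.take_append_of_le_length (by rwa [y.length_initialWord]), ih]

theorem ediam_cyl_le (k : ℕ) (u : List (Fin m)) :
    Metric.ediam (cyl k u) ≤ ENNReal.ofReal ((m : ℝ) ^ (k + 1))⁻¹ :=
  Metric.ediam_le fun x hx y hy => by
    rw [edist_dist]
    exact ENNReal.ofReal_le_ofReal (dist_le_of_initialWord_eq (hx.trans hy.symm))

/-- Upper half of the mass distribution principle for cylinders. -/
theorem hausdorffMeasure_le_one (hm : 2 ≤ m) (μ : Measure (SymbolSpace m)) [IsProbabilityMeasure μ]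
    {X : Set (SymbolSpace m)} {s : ℝ} (hs : 0 < s)
    (h : ∀ x ∈ X, ∀ N : ℕ, ∃ n ≥ N, ENNReal.ofReal ((m : ℝ) ^ (-(s * n))) ≤
      μ (cyl n (x.initialWord n))) : Measure.hausdorffMeasure s X ≤ 1 := by
  classical
  have hm1 : (1 : ℝ) < m := by exact_mod_cast hm
  have hm0 : (0 : ℝ) < m := by linarith
  set good : List (Fin m) → Prop := fun u =>
    ENNReal.ofReal ((m : ℝ) ^ (-(s * u.length))) ≤ μ (cyl u.length u) with hgood
  -- A stopping rule: cylinders that are good for the first time after N are pairwise disjoint, so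
  -- their masses sum to at most 1, and they cover X.
  set firstGood : ℕ → List (Fin m) → Prop := fun N u =>
    N ≤ u.length ∧ good u ∧ ∀ j < u.length, N ≤ j → ¬ good (u.take j) with hfirst
  set c : ℕ → List (Fin m) → Set (SymbolSpace m) := fun N u =>
    if firstGood N u then cyl u.length u else ∅ with hc
  have hmeas : ∀ N u, MeasurableSet (c N u) := fun N u => by
    simp only [hc]; split_ifs
    · exact measurableSet_cyl _ _
    · exact MeasurableSet.empty
  have hmem : ∀ {N u y}, y ∈ c N u → y.initialWord u.length = u ∧ firstGood N u := by
    intro N u y hy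
    simp only [hc] at hy
    split_ifs at hy with h1
    · exact ⟨hy, h1⟩
    · exact hy.elim
  have hdisj : ∀ N, Pairwise (Function.onFun Disjoint (c N)) := by
    intro N u v huv
    rw [Function.onFun, Set.disjoint_left]
    intro y hu hv
    have key : ∀ {u v : List (Fin m)}, y ∈ c N u → y ∈ c N v → ¬ u.length < v.length := by
      intro u v hu hv hlt
      obtain ⟨hu1, hu2⟩ := hmem hu
      obtain ⟨hv1, hv2⟩ := hmem hv
      refine hv2.2.2 _ hlt hu2.1 ?_
      rw [← hv1, y.take_initialWord hlt.le, hu1]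
      exact hu2.2.1
    have hlen : u.length = v.length :=
      le_antisymm (not_lt.1 (key hv hu)) (not_lt.1 (key hu hv))
    apply huv
    rw [← (hmem hu).1, ← (hmem hv).1, hlen]
  have hr : Tendsto (fun N : ℕ => ENNReal.ofReal ((m : ℝ) ^ (N + 1))⁻¹) atTop (𝓝 0) := by
    have h1 : Tendsto (fun N : ℕ => ((m : ℝ) ^ (N + 1))⁻¹) atTop (𝓝 0) :=
      ((tendsto_pow_atTop_atTop_of_one_lt hm1).comp (tendsto_add_atTop_nat 1)).inv_tendsto_atTop
    simpa using ENNReal.tendsto_ofReal h1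
  refine (Measure.hausdorffMeasure_le_liminf_tsum s X _ hr c (Eventually.of_forall fun N u => ?_)
    (Eventually.of_forall fun N x hx => ?_)).trans ?_
  · simp only [hc]
    split_ifs with h1
    · refine (ediam_cyl_le _ _).trans (ENNReal.ofReal_le_ofReal ?_)
      exact inv_anti₀ (by positivity) (pow_le_pow_right₀ hm1.le (by have := h1.1; omega))
    · rw [Metric.ediam_empty]; exact zero_le
  · have hex : ∃ n, N ≤ n ∧ good (x.initialWord n) := by
      obtain ⟨n, hn, hn'⟩ := h x hx N
      refine ⟨n, hn, ?_⟩
      simp only [hgood, x.length_initialWord]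
      exact hn'
    refine Set.mem_iUnion.2 ⟨x.initialWord (Nat.find hex), ?_⟩
    have hst : firstGood N (x.initialWord (Nat.find hex)) := by
      refine ⟨by rw [x.length_initialWord]; exact (Nat.find_spec hex).1, (Nat.find_spec hex).2, ?_⟩
      intro j hj hNj hgj
      rw [x.length_initialWord] at hj
      rw [x.take_initialWord hj.le] at hgj
      exact Nat.find_min hex hj ⟨hNj, hgj⟩
    simp only [hc, if_pos hst]
    change x.initialWord _ = _
    rw [x.length_initialWord]
  · refine liminf_le_of_le (by isBoundedDefault) fun b hb => ?_
    obtain ⟨N, hN⟩ := hb.exists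
    refine hN.trans ?_
    calc ∑' u, Metric.ediam (c N u) ^ s ≤ ∑' u, μ (c N u) := ENNReal.tsum_le_tsum fun u => ?_
      _ = μ (⋃ u, c N u) := (measure_iUnion (hdisj N) (hmeas N)).symm
      _ ≤ 1 := prob_le_one
    simp only [hc]
    split_ifs with h1
    · refine le_trans ?_ h1.2.1
      refine (ENNReal.rpow_le_rpow (ediam_cyl_le _ _) hs.le).trans ?_
      rw [ENNReal.ofReal_rpow_of_pos (by positivity)]
      refine ENNReal.ofReal_le_ofReal ?_
      rw [← Real.rpow_natCast, ← Real.rpow_neg hm0.le, ← Real.rpow_mul hm0.le]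
      refine Real.rpow_le_rpow_of_exponent_le hm1.le ?_
      push_cast
      nlinarith
    · rw [Metric.ediam_empty, ENNReal.zero_rpow_of_pos hs]; exact zero_le

/-- Lower half of the mass distribution principle for cylinders. -/
theorem hausdorffMeasure_ne_zero (hm : 2 ≤ m) {α : Type*} [MeasurableSpace α] (Q : Measure α)
    [IsProbabilityMeasure Q] {f : α → SymbolSpace m} (hf : Measurable f)
    {X : Set (SymbolSpace m)} {s : ℝ} (hs : 0 < s) (hX : ∀ᵐ a ∂Q, f a ∈ X)
    (h : ∀ᵐ a ∂Q, ∀ᶠ n : ℕ in atTop, Q (f ⁻¹' cyl n ((f a).initialWord n)) ≤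
      ENNReal.ofReal ((m : ℝ) ^ (-(s * n)))) : Measure.hausdorffMeasure s X ≠ 0 := by
  have hm1 : (1 : ℝ) < m := by exact_mod_cast hm
  have hm0 : (0 : ℝ) < m := by linarith
  set A : ℕ → Set α := fun N => {a | f a ∈ X ∧ ∀ n ≥ N, Q (f ⁻¹' cyl n ((f a).initialWord n)) ≤
      ENNReal.ofReal ((m : ℝ) ^ (-(s * n)))} with hA
  obtain ⟨N, hN⟩ : ∃ N, Q (A N) ≠ 0 := by
    by_contra! hcon
    have h1 := measure_iUnion_null hcon
    have h2 : ∀ᵐ a ∂Q, a ∈ ⋃ N, A N := by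
      filter_upwards [hX, h] with a ha1 ha2
      obtain ⟨N, hN⟩ := eventually_atTop.1 ha2
      exact Set.mem_iUnion.2 ⟨N, ha1, hN⟩
    have h3 : Q (⋃ N, A N) = 1 := by
      have h4 : (⋃ N, A N) =ᵐ[Q] Set.univ := eventuallyEq_univ.2 h2
      rw [measure_congr h4, measure_univ]
    rw [h1] at h3
    exact zero_ne_one h3
  -- Restricting to `A N` makes the mass bound uniform: a cylinder of length n ≥ N either has ν-mass
  -- 0 or contains f a for some a ∈ `A N`.
  set ν := (Q.restrict (A N)).map f with hν
  have hcyl : ∀ n ≥ N, ∀ u, ν (cyl n u) ≤ ENNReal.ofReal ((m : ℝ) ^ (-(s * n))) := by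
    intro n hn u
    have hmc := hf (measurableSet_cyl n u)
    rw [hν, Measure.map_apply hf (measurableSet_cyl n u), Measure.restrict_apply hmc]
    rcases (f ⁻¹' cyl n u ∩ A N).eq_empty_or_nonempty with h0 | ⟨a, ha1, ha2⟩
    · rw [h0, measure_empty]; exact zero_le
    · refine (measure_mono Set.inter_subset_left).trans ?_
      have := ha2.2 n hn
      rwa [show (f a).initialWord n = u from ha1] at this
  have hνX : ν X ≠ 0 := by
    have h1 : Q (A N) ≤ Q.restrict (A N) (f ⁻¹' X) := by
      refine le_trans (measure_mono ?_) (Measure.le_restrict_apply _ _)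
      exact fun a ha => ⟨ha.1, ha⟩
    have h2 := Measure.le_map_apply (μ := Q.restrict (A N)) hf.aemeasurable X
    intro h0
    rw [← hν, h0] at h2
    exact hN (le_antisymm (h1.trans h2) (zero_le))
  -- The factor m^(-s) pays for rounding the diameter d to m^(-(n+1)) ≤ d < m^(-n), where S lies in
  -- a cylinder of length n.
  set c : ℝ≥0∞ := ENNReal.ofReal ((m : ℝ) ^ (-s)) with hc
  have hc0 : c ≠ 0 := by
    rw [hc, Ne, ENNReal.ofReal_eq_zero, not_le]; positivity
  have hle : c • ν ≤ Measure.hausdorffMeasure s := by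
    refine Measure.le_hausdorffMeasure s _ (ENNReal.ofReal ((m : ℝ) ^ (N + 1))⁻¹)
      (ENNReal.ofReal_pos.2 (by positivity)) fun S hS => ?_
    rcases S.eq_empty_or_nonempty with rfl | ⟨x, hx⟩
    · simp
    rw [Measure.smul_apply, smul_eq_mul]
    have hfin : Metric.ediam S ≠ ⊤ := ne_top_of_le_ne_top ENNReal.ofReal_ne_top hS
    set d := (Metric.ediam S).toReal with hd
    have hdS : Metric.ediam S = ENNReal.ofReal d := (ENNReal.ofReal_toReal hfin).symm
    have hd0 : 0 ≤ d := ENNReal.toReal_nonneg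
    have hdN : d ≤ ((m : ℝ) ^ (N + 1))⁻¹ := ENNReal.toReal_le_of_le_ofReal (by positivity) hS
    have hdist : ∀ y ∈ S, dist y x ≤ d := fun y hy => by
      rw [dist_edist]
      exact ENNReal.toReal_mono hfin (Metric.edist_le_ediam_of_mem hy hx)
    have hsub : ∀ n : ℕ, d < ((m : ℝ) ^ n)⁻¹ → S ⊆ cyl n (x.initialWord n) := fun n hn y hy =>
      initialWord_eq_of_dist_lt ((hdist y hy).trans_lt hn)
    have hbound : ∀ n ≥ N, d < ((m : ℝ) ^ n)⁻¹ →
        c * ν S ≤ ENNReal.ofReal ((((m : ℝ) ^ (n + 1))⁻¹) ^ s) := by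
      intro n hn hdn
      have h1 := (measure_mono (μ := ν) (hsub n hdn)).trans (hcyl n hn _)
      refine (mul_le_mul_right h1 c).trans ?_
      rw [hc, ← ENNReal.ofReal_mul (by positivity)]
      refine ENNReal.ofReal_le_ofReal (le_of_eq ?_)
      rw [← Real.rpow_add hm0, ← Real.rpow_natCast, ← Real.rpow_neg hm0.le, ← Real.rpow_mul hm0.le]
      congr 1
      push_cast
      ring
    rcases hd0.eq_or_lt with hd0 | hd0
    · rw [hdS, ← hd0, ENNReal.ofReal_zero, ENNReal.zero_rpow_of_pos hs]
      have hlim : Tendsto (fun n : ℕ => ENNReal.ofReal ((((m : ℝ) ^ (n + 1))⁻¹) ^ s)) atTop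
          (𝓝 0) := by
        have h1 : Tendsto (fun N : ℕ => ((m : ℝ) ^ (N + 1))⁻¹) atTop (𝓝 0) :=
          ((tendsto_pow_atTop_atTop_of_one_lt hm1).comp
            (tendsto_add_atTop_nat 1)).inv_tendsto_atTop
        have h2 := h1.rpow_const (p := s) (Or.inr hs.le)
        rw [Real.zero_rpow hs.ne'] at h2
        simpa using ENNReal.tendsto_ofReal h2
      refine ge_of_tendsto hlim ?_
      filter_upwards [eventually_ge_atTop N] with n hn
      exact hbound n hn (by rw [← hd0]; positivity)
    · have hex : ∃ n : ℕ, ((m : ℝ) ^ (n + 1))⁻¹ ≤ d := by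
        obtain ⟨n, hn⟩ := exists_inv_pow_lt hm hd0
        exact ⟨n, hn.le⟩
      classical
      set n := Nat.find hex with hn
      have h1 : ((m : ℝ) ^ (n + 1))⁻¹ ≤ d := Nat.find_spec hex
      have h2 : N ≤ n := by
        by_contra hlt
        have h3 := h1.trans hdN
        have h4 : ((m : ℝ) ^ (N + 1))⁻¹ < ((m : ℝ) ^ (n + 1))⁻¹ :=
          inv_strictAnti₀ (by positivity) (pow_lt_pow_right₀ hm1 (by omega))
        linarith
      have h3 : d < ((m : ℝ) ^ n)⁻¹ := by
        rcases Nat.eq_zero_or_pos n with h0 | h0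
        · rw [h0]
          refine hdN.trans_lt (inv_strictAnti₀ (by positivity) (pow_lt_pow_right₀ hm1 (by omega)))
        · have := Nat.find_min hex (m := n - 1) (by omega)
          rwa [not_le, Nat.sub_add_cancel h0] at this
      refine (hbound n h2 h3).trans ?_
      rw [hdS, ENNReal.ofReal_rpow_of_pos hd0]
      exact ENNReal.ofReal_le_ofReal (Real.rpow_le_rpow (by positivity) h1 hs.le)
  have hX' : c * ν X ≤ Measure.hausdorffMeasure s X := hle X
  intro h0
  rw [h0] at hX'
  exact mul_ne_zero hc0 hνX (le_antisymm hX' (zero_le))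

end Hausdorff

/-! ### The two dimension bounds -/

section Dimension

open SymbolSpace

variable {m : ℕ} {P : Finset ℕ} {Ω : Set (SymbolSpace m)} {t : List (Fin m) → ℝ}

theorem tendsto_root_mul_copCount (hP : ∀ p ∈ P, p.Prime) (hne : P.Nonempty) (L : ℝ) :
    Tendsto (fun n : ℕ => gammaS P * L * copCount P n / n) atTop (𝓝 L) := by
  have hγ : gammaS P ≠ 0 := (zero_lt_one.trans_le (one_le_gammaS hP hne)).ne'
  have h := (tendsto_copCount_div hP hne).const_mul (gammaS P * L)
  rw [show gammaS P * L * (gammaS P)⁻¹ = L by field_simp] at h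
  exact h.congr fun n => by ring

theorem dimH_multSet_le (hP : ∀ p ∈ P, p.Prime) (hne : P.Nonempty) (hm : 2 ≤ m)
    (hΩne : Ω.Nonempty) (ht : ∀ u ∈ Pref Ω, 1 ≤ t u)
    (heq : ∀ u ∈ Pref Ω, t u ^ nodeExp P u.length = childSum Ω t u) :
    dimH (multSet P Ω) ≤ ENNReal.ofReal (Real.logb m (t [])) := by
  have hlog : 0 < Real.log m := Real.log_pos (by exact_mod_cast hm)
  have hm0 : (0 : ℝ) < m := by positivity
  set L := Real.log (t []) with hL
  have hL0 : 0 ≤ L := Real.log_nonneg (ht _ (nil_mem_Pref hΩne))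
  have := fun u => isProbabilityMeasure_letterLaw hm ht u
  refine ENNReal.le_of_forall_pos_le_add fun η hη _ => ?_
  set s : ℝ := Real.logb m (t []) + η with hs
  have hη' : (0 : ℝ) < η := by exact_mod_cast hη
  have hlb : 0 ≤ Real.logb m (t []) := div_nonneg hL0 hlog.le
  have hs0 : 0 < s := by linarith
  have hsL : s * Real.log m = L + η * Real.log m := by
    rw [hs, Real.logb, add_mul, div_mul_cancel₀ _ hlog.ne']
  -- Half of the gap absorbs the error in counting the integers prime to `P`, the other half the
  -- excess.
  have hκ : 0 < η * Real.log m / 2 := by positivity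
  have hfw := measurable_weave (P := P) hP hne hm
  have : IsProbabilityMeasure ((forestLaw Ω t).map (weave P)) :=
    Measure.isProbabilityMeasure_map hfw.aemeasurable
  have hH : Measure.hausdorffMeasure s (multSet P Ω) ≤ 1 := by
    refine hausdorffMeasure_le_one hm ((forestLaw Ω t).map (weave P)) hs0 fun x hx N => ?_
    obtain ⟨N₁, hN₁⟩ := eventually_atTop.1 ((tendsto_root_mul_copCount hP hne L).eventually_lt_const
      (show L < L + η * Real.log m / 2 by linarith))
    obtain ⟨n, hn, hn'⟩ := exists_neg_mul_le_excessSum hP hne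
      (a := fun i => nodeLog Ω t (restr P x i)) (fun i => nodeLog_zero _)
      (fun i k => wordLog_nonneg ht _) hκ (N + N₁ + 1)
    refine ⟨n, by omega, ?_⟩
    rw [Measure.map_apply hfw (measurableSet_cyl _ _), forestLaw_weave_cyl hP hne hm ht heq hx]
    refine ENNReal.ofReal_le_ofReal ?_
    rw [Real.rpow_def_of_pos hm0]
    refine Real.exp_le_exp.2 ?_
    have hn0 : (0 : ℝ) < n := by exact_mod_cast (by omega : 0 < n)
    have h1 := hN₁ n (by omega)
    rw [div_lt_iff₀ hn0] at h1
    have e : Real.log m * -(s * n) = -((L + η * Real.log m) * n) := by rw [← hsL]; ring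
    rw [e]
    linarith
  have h2 := dimH_le_of_hausdorffMeasure_ne_top (d := s.toNNReal) (s := multSet P Ω) (by
    rw [Real.coe_toNNReal _ hs0.le]
    exact ne_top_of_le_ne_top ENNReal.one_ne_top hH)
  refine h2.trans_eq ?_
  change ENNReal.ofReal s = _
  rw [hs, ENNReal.ofReal_add hlb hη'.le, ENNReal.ofReal_coe_nnreal]

theorem le_dimH_multSet (hP : ∀ p ∈ P, p.Prime) (hne : P.Nonempty) (hm : 2 ≤ m)
    (hΩ : IsClosed Ω) (hΩne : Ω.Nonempty)
    (ht : ∀ u ∈ Pref Ω, t u ∈ Set.Icc 1 (nodeBound m P u.length))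
    (heq : ∀ u ∈ Pref Ω, t u ^ nodeExp P u.length = childSum Ω t u) :
    ENNReal.ofReal (Real.logb m (t [])) ≤ dimH (multSet P Ω) := by
  have hlog : 0 < Real.log m := Real.log_pos (by exact_mod_cast hm)
  have hm0 : (0 : ℝ) < m := by positivity
  have ht1 : ∀ u ∈ Pref Ω, 1 ≤ t u := fun u hu => (ht u hu).1
  set L := Real.log (t []) with hL
  have := fun u => isProbabilityMeasure_letterLaw hm ht1 u
  refine ENNReal.le_of_forall_nnreal_lt fun s hs => ?_
  rcases eq_or_ne s 0 with rfl | hs0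
  · exact zero_le
  have hs0' : (0 : ℝ) < s := by exact_mod_cast pos_iff_ne_zero.2 hs0
  have hsL : s * Real.log m < L := by
    have h1 : (s : ℝ) < Real.logb m (t []) := by
      rw [← ENNReal.ofReal_coe_nnreal] at hs
      exact (ENNReal.ofReal_lt_ofReal_iff_of_nonneg s.2).1 hs
    rwa [Real.logb, lt_div_iff₀ hlog] at h1
  -- Again half of the gap for each of the two errors.
  set κ := (L - s * Real.log m) / 2 with hκ
  have hκ0 : 0 < κ := by rw [hκ]; linarith
  have hfw := measurable_weave (P := P) hP hne hm
  have hmem := ae_path_forest_mem (t := t) hm hΩ hΩne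
  refine le_dimH_of_hausdorffMeasure_ne_zero (hausdorffMeasure_ne_zero hm (forestLaw Ω t) hfw hs0'
    (hmem.mono fun ω hω => weave_mem_multSet hP hne hω) ?_)
  filter_upwards [hmem, ae_eventually_excessSum_le hP hne hm hΩ hΩne ht heq hκ0] with ω hω1 hω2
  filter_upwards [hω2, eventually_gt_atTop 0, (tendsto_root_mul_copCount hP hne L).eventually_const_lt
      (show L - κ < L by linarith)] with n h1 h2 h3
  rw [forestLaw_weave_cyl hP hne hm ht1 heq (weave_mem_multSet hP hne hω1)]
  refine ENNReal.ofReal_le_ofReal ?_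
  rw [Real.rpow_def_of_pos hm0]
  refine Real.exp_le_exp.2 ?_
  have hn0 : (0 : ℝ) < n := by exact_mod_cast h2
  rw [lt_div_iff₀ hn0] at h3
  have e0 : excessSum P (fun i => nodeLog Ω t (restr P (weave P ω) i)) n =
      excessSum P (fun i => nodeLog Ω t (path (ω i))) n :=
    Finset.sum_congr rfl fun i hi => by
      simp only [restr_weave hP hne ω (Finset.mem_filter.1 hi).2]
  rw [e0]
  have e : Real.log m * -(s * n) = -((L - 2 * κ) * n) := by rw [hκ]; ring
  rw [e]
  linarith

end Dimension

theorem theorem2p5 (m : ℕ) (hm : 2 ≤ m) (P : Finset ℕ) (hP : ∀ p ∈ P, p.Prime)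
    (hJ : 2 ≤ P.card) (Ω : Set (SymbolSpace m)) (hΩ : IsClosed Ω) (hne : Ω.Nonempty) :
    (∃ t : List (Fin m) → ℝ, IsTreeSolution P Ω t) ∧
      ∀ t : List (Fin m) → ℝ, IsTreeSolution P Ω t →
        dimH (multSet P Ω) = ENNReal.ofReal (Real.logb m (t [])) := by
  have hPne : P.Nonempty := Finset.card_pos.1 (by omega)
  refine ⟨exists_isTreeSolution hP hPne (by omega) hne, fun t ht => ?_⟩
  have h := (isTreeSolution_iff hP hPne hne).1 ht
  exact le_antisymm
    (dimH_multSet_le hP hPne hm hne (fun u hu => (h u hu).1.1) fun u hu => (h u hu).2)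
    (le_dimH_multSet hP hPne hm hΩ hne (fun u hu => (h u hu).1) fun u hu => (h u hu).2)
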